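/- **Proposition 3.11.** Let $(N,g)$ be a smooth (Hausdorff) $n$-dimensional Riemannian manifold with Christoffel symbols $\Gamma^c_{ab}$. On the tangent bundle $TN$, with induced local coordinates $(x^a,y^a)$, let $\frac{\delta}{\delta x^a}=\frac{\partial}{\partial x^a}-\Gamma^b_{ac}y^c\frac{\partial}{\partial y^b}$. Let $V$ and $H$ be the projectors of $T(TN)$ onto the vertical distribution, spanned by the $\frac{\partial}{\partial y^a}$, and the horizontal distribution, spanned by the $\frac{\delta}{\delta x^a}$. Let $G$ be the Sasaki metric on $TN$, that is, $G(\frac{\delta}{\delta x^a},\frac{\delta}{\delta x^b})=G(\frac{\partial}{\partial y^a},\frac{\partial}{\partial y^b})=g_{ab}$ and $G(\frac{\delta}{\delta x^a},\frac{\partial}{\partial y^b})=0$. Let $\theta=\frac12\frac{\partial F^2}{\partial y^a}dx^a$ with $F=(g_{uv}y^uy^v)^{1/2}$ be the Cartan form. For $Q\in\{V,H\}$ and $Q'=1-Q$, let $\nabla^{Q}$ be the connection on the distribution $\operatorname{im}Q$ given by $\nabla^{Q}_{Q'X}QY=Q[Q'X,QY]$ and $$\begin{aligned}2G(\nabla^{Q}_{QX}QY,QZ)={}&QX\,(G(QY,QZ))+QY\,(G(QZ,QX))-QZ\,(G(QX,QY))\\&+G(Q[QX,QY],QZ)-G(Q[QY,QZ],QX)+G(Q[QZ,QX],QY)\\&+\theta(QX)G(QY,QZ)+\theta(QY)G(QZ,QX)-\theta(QZ)G(QX,QY).\end{aligned}$$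 The Vranceanu–Cartan connection on $TN$ is $\nabla^*_XY=\nabla^{V}_XVY+\nabla^{H}_XHY$. Let $T^*$ and $R^*$ be its torsion and curvature. Then, with $X,Y,Z$ denoting smooth vector fields on $TN$: 1. $T^*=0$ if and only if $(N,g)$ is flat, i.e. the Riemann curvature tensor of $g$ vanishes. 2. $R^*(HX,HY)VZ=0$ for all $X,Y,Z$ if and only if $(N,g)$ is flat. 3. If $n\ge1$, then $\nabla^*$ is never vertical-horizontal flat, and indeed $R^*(V\cdot,H\cdot)$ vanishes at no point: for every $u\in TN$ there are $X,Y,Z$ with $\big(R^*(VX,HY)Z\big)(u)\neq0$. 4. $\nabla^*$ is always vertical flat: $R^*(VX,VY)Z=0$ for all $X,Y,Z$. -/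

import Mathlib

open scoped Manifold ContDiff

noncomputable section

namespace VranceanuCartan

section General

variable {E H M : Type*} [NormedAddCommGroup E] [NormedSpace ℝ E] [TopologicalSpace H]
  (I : ModelWithCorners ℝ E H) [TopologicalSpace M] [ChartedSpace H M]

/-- Vector fields on `M`, with no regularity required. -/
abbrev VField (M : Type*) [TopologicalSpace M] [ChartedSpace H M] : Type _ :=
  (x : M) → TangentSpace I x

/-- A fibrewise endomorphism of `TM`, used for the projectors of a splitting of `TM`. -/
abbrev Endo (M : Type*) [TopologicalSpace M] [ChartedSpace H M] : Type _ :=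
  (x : M) → TangentSpace I x → TangentSpace I x

/-- A fibrewise real-valued pairing on `TM`, used for Riemannian metrics. -/
abbrev Pairing (M : Type*) [TopologicalSpace M] [ChartedSpace H M] : Type _ :=
  (x : M) → TangentSpace I x → TangentSpace I x → ℝ

/-- A fibrewise real-valued function on `TM`, used for 1-forms. -/
abbrev Form (M : Type*) [TopologicalSpace M] [ChartedSpace H M] : Type _ :=
  (x : M) → TangentSpace I x → ℝ

variable {I}

/-- The vector field `X` is smooth near `x`. -/
def SmoothFieldAt [IsManifold I 1 M] (X : VField I M) (x : M) : Prop :=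
  ContMDiffAt I I.tangent ∞ (fun y => (⟨y, X y⟩ : TangentBundle I M)) x

/-- `X` is a (global) smooth vector field, `X ∈ χ(M)`. -/
def SmoothField [IsManifold I 1 M] (X : VField I M) : Prop :=
  ContMDiff I I.tangent ∞ (fun y => (⟨y, X y⟩ : TangentBundle I M))

/-- `QX`, the image of the vector field `X` under a projector `Q`. -/
def Endo.app (Q : Endo I M) (X : VField I M) : VField I M := fun x => Q x (X x)

/-- The derivative `X(f)` of the function `f` along the vector field `X`. -/
def along (X : VField I M) (f : M → ℝ) (x : M) : ℝ :=
  mfderiv I 𝓘(ℝ, ℝ) f x (X x)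

/-- The right-hand side of the generalized Koszul formula for sections `X, Y, Z` of a distribution
with projector `Q`, a metric `G`, and a Weyl structure whose 1-form at `G` is `W`. -/
def koszul (G : Pairing I M) (W : Form I M) (Q : Endo I M) (X Y Z : VField I M) (x : M) : ℝ :=
  along X (fun y => G y (Y y) (Z y)) x
    + along Y (fun y => G y (Z y) (X y)) x
    - along Z (fun y => G y (X y) (Y y)) x
    + G x (Q x (VectorField.mlieBracket I X Y x)) (Z x)
    - G x (Q x (VectorField.mlieBracket I Y Z x)) (X x)
    + G x (Q x (VectorField.mlieBracket I Z X x)) (Y x)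
    + W x (X x) * G x (Y x) (Z x)
    + W x (Y x) * G x (Z x) (X x)
    - W x (Z x) * G x (X x) (Y x)

open Classical in
/-- `∇_{QX} QY`, the vector field with values in the distribution `D = im Q` determined by
`2 G(∇_{QX} QY, QZ) = koszul (QX, QY, QZ)` for all smooth `Z`. For smooth data, `G` nondegenerate
on `D`, and fields `QX`, `QY` smooth near `x`, there is exactly one such vector at `x`, because the
right-hand side is tensorial in `QZ`. (The value is `0` where there is none, which does not
happen for such data.) -/
def koszulDeriv [IsManifold I 1 M] (G : Pairing I M) (W : Form I M) (Q : Endo I M)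
    (X Y : VField I M) : VField I M :=
  fun x =>
    if h : ∃ v : TangentSpace I x, Q x v = v ∧ ∀ Z : VField I M, SmoothFieldAt Z x →
        2 * G x v (Q x (Z x)) = koszul G W Q (Q.app X) (Q.app Y) (Q.app Z) x
    then h.choose else 0

/-- `∇_X QY`, where `∇` is the Weyl connection on the distribution `D = im Q` with complementary
distribution `D' = im Q'`: `∇_X QY = ∇_{QX} QY + ∇_{Q'X} QY`, the first term by the generalized
Koszul formula, the second one being `Q[Q'X, QY]`. -/
def weylConn [IsManifold I 1 M] (G : Pairing I M) (W : Form I M) (Q Q' : Endo I M)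
    (X Y : VField I M) : VField I M :=
  fun x => koszulDeriv G W Q X Y x + Q x (VectorField.mlieBracket I (Q'.app X) (Q.app Y) x)

/-- The Vranceanu connection `∇*_X Y = ∇_X QY + ∇^⊥_X Q^⊥Y` of a Weyl structure, with respect to
the orthogonal splitting of `TM` with projectors `Q` and `Q'` (`= Q^⊥`). -/
def vranceanu [IsManifold I 1 M] (G : Pairing I M) (W : Form I M) (Q Q' : Endo I M)
    (X Y : VField I M) : VField I M :=
  fun x => weylConn G W Q Q' X Y x + weylConn G W Q' Q X Y x

/-- The torsion `T(X,Y) = D_X Y - D_Y X - [X,Y]`. -/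
def torsion (D : VField I M → VField I M → VField I M) (X Y : VField I M) : VField I M :=
  fun x => D X Y x - D Y X x - VectorField.mlieBracket I X Y x

/-- The curvature `R(X,Y)Z = D_X D_Y Z - D_Y D_X Z - D_{[X,Y]} Z`. -/
def curvature (D : VField I M → VField I M → VField I M) (X Y Z : VField I M) : VField I M :=
  fun x => D X (D Y Z) x - D Y (D X Z) x - D (VectorField.mlieBracket I X Y) Z x

end General

section Riemannian

variable {n : ℕ} {N : Type*} [TopologicalSpace N] [ChartedSpace (EuclideanSpace ℝ (Fin n)) N]
  [IsManifold (𝓡 n) ∞ N]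

/-- A smooth Riemannian metric on the `n`-dimensional manifold `N`. -/
abbrev Metric (n : ℕ) (N : Type*) [TopologicalSpace N]
    [ChartedSpace (EuclideanSpace ℝ (Fin n)) N] [IsManifold (𝓡 n) ∞ N] : Type _ :=
  Bundle.ContMDiffRiemannianMetric (𝓡 n) ∞ (EuclideanSpace ℝ (Fin n))
    (fun x : N => TangentSpace (𝓡 n) x)

variable (g : Metric n N)

/-- The Levi-Civita connection of `(N, g)`: the Koszul formula with the full tangent bundle as
distribution and without Weyl 1-form. -/
def leviCivita (X Y : VField (𝓡 n) N) : VField (𝓡 n) N :=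
  koszulDeriv (fun x v w => g.inner x v w) (fun _ _ => 0) (fun _ v => v) X Y

/-- `(N, g)` is flat: the Riemann curvature tensor of `g` vanishes. -/
def IsFlat : Prop :=
  ∀ X Y Z : VField (𝓡 n) N, SmoothField X → SmoothField Y → SmoothField Z →
    ∀ x : N, curvature (leviCivita g) X Y Z x = 0

/-- The Christoffel symbols at `p` in the preferred chart at `p`, `Γ_p(v,w) = Γ^c_{ab} v^a w^b ∂_c`,
that is, `(∇_V W)(p)` for the vector fields `V`, `W` which in the coordinates of this chart have
the constant components `v`, `w`. -/
def christoffel (p : N) (v w : TangentSpace (𝓡 n) p) : TangentSpace (𝓡 n) p :=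
  leviCivita g (FiberBundle.extend (EuclideanSpace ℝ (Fin n)) v)
    (FiberBundle.extend (EuclideanSpace ℝ (Fin n)) w) p

/-- The horizontal projector `H` of `TN`. A tangent vector `ξ` to `TN` at `u = (p, y)` is the pair
`(a, b)` of its components in the coordinates `(x, y)` of `TN` induced by the preferred chart of
`N` at `p`; so `a` is the projection of `ξ` to `T_p N`, and
`Hξ = a^c δ/δx^c` with `δ/δx^c = ∂/∂x^c - Γ^b_{cd} y^d ∂/∂y^b`. -/
def hor : Endo (𝓡 n).tangent (TangentBundle (𝓡 n) N) := fun u ξ =>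
  ((ξ.1, -christoffel g u.proj ξ.1 u.snd) :
    EuclideanSpace ℝ (Fin n) × EuclideanSpace ℝ (Fin n))

/-- The vertical projector `V = 1 - H` of `TN`:
`Vξ = (b^c + Γ^c_{ad} a^a y^d) ∂/∂y^c` for `ξ = (a, b)`. -/
def vert : Endo (𝓡 n).tangent (TangentBundle (𝓡 n) N) := fun u ξ => ξ - hor g u ξ

/-- The Sasaki metric `G` on `TN`: `G(δ/δx^a, δ/δx^b) = G(∂/∂y^a, ∂/∂y^b) = g_ab` and
`G(δ/δx^a, ∂/∂y^b) = 0`. -/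
def sasaki : Pairing (𝓡 n).tangent (TangentBundle (𝓡 n) N) := fun u ξ η =>
  g.inner u.proj ξ.1 η.1 + g.inner u.proj (vert g u ξ).2 (vert g u η).2

/-- The Finsler fundamental function `F = (g_{uv} y^u y^v)^{1/2}` of the Riemannian metric. -/
def finslerF (u : TangentBundle (𝓡 n) N) : ℝ := Real.sqrt (g.inner u.proj u.snd u.snd)

/-- The Cartan form `θ_F = (1/2) (∂F²/∂y^a) dx^a` on `TN`: its value on `ξ = (a, b)` is half the
derivative of `F²` along the fibre in the direction `a`. -/
def cartanForm : Form (𝓡 n).tangent (TangentBundle (𝓡 n) N) := fun u ξ =>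
  (1 / 2) * deriv (fun t : ℝ =>
    finslerF g ⟨u.proj, u.snd + t • (show TangentSpace (𝓡 n) u.proj from ξ.1)⟩ ^ 2) 0

/-- The Vranceanu–Cartan connection `∇*` on `TN`: the Vranceanu connection of the Weyl structure
`G ↦ θ_F` on `TN`, for the splitting of `T(TN)` into the vertical and the horizontal distribution. -/
def connection (X Y : VField (𝓡 n).tangent (TangentBundle (𝓡 n) N)) :
    VField (𝓡 n).tangent (TangentBundle (𝓡 n) N) :=
  vranceanu (sasaki g) (cartanForm g) (vert g) (hor g) X Y

end Riemannian

end VranceanuCartan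

end

/-! In induced coordinates (x, y) on TN, record a tangent vector (a, b) by its horizontal component
a and its vertical component b + Γ(a, y) (`horComp`, `vertComp`). In these components ∇* becomes a
pair of connections on trivial bundles (`comp_connection`).

On V, the fibre metric g_ab(x) does not depend on y and θ kills vertical vectors, so the Koszul
formula yields plain differentiation along the fibres; the mixed bracket V[HX, VY] contributes Γ in
horizontal directions. Thus ∇^V is the pullback of the Levi-Civita connection. On H, the Koszul
formula yields Γ + S with S(a, c) = ½(θ(a)c + θ(c)a - g(a, c)y), and H[VX, HY] is plain
differentiation along the fibres. Both connection forms involve dx only.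

The curvature of a connection form A is dA + A∧A (`covDeriv_curvature`). On V this is the Riemann
tensor of g, fed with the horizontal components of the first two arguments and the vertical
component of the third; this decides the second claim. On H, a form in dx alone has no curvature on
two vertical vectors, which with the V part gives the fourth claim. On a vertical b and any w only
the y-derivative of S survives, and S is linear in y, so the curvature applied to c is ½(g(b, w)c +
g(b, c)w - g(w, c)b). For b = w = c this is ½ g(b, b)b, nonzero for b ≠ 0: the third claim.

The horizontal part of the torsion vanishes because Γ + S is symmetric. Its vertical part is R(a,
a')y, since the bracket of horizontal fields has vertical part -R(a, a')y (`vertComp_mlieBracket`).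
As y is arbitrary, the torsion vanishes exactly when R does.

Two points need care. The horizontal projector is defined at each point through the preferred chart
there, so its expression in one fixed chart rests on a cancellation between the inhomogeneous terms
in the transformation laws of b and of Γ (`chartD_tangent`, `chartD_christoffel`, `chartD_hor`). And
passing between tensors at a point and global smooth fields uses bump functions, hence a Hausdorff
TN. -/

noncomputable section

namespace VranceanuCartan

open Set Filter Topology VectorField

/-! ### Vector fields, directional derivatives and Lie brackets in a chart. -/

section Chart

variable {F H M : Type*} [NormedAddCommGroup F] [NormedSpace ℝ F] [TopologicalSpace H]
  {I : ModelWithCorners ℝ F H} [TopologicalSpace M] [ChartedSpace H M] [IsManifold I ∞ M]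

/-- The derivative at `x` of the preferred chart at `x₀`. -/
def chartD (I : ModelWithCorners ℝ F H) [IsManifold I ∞ M] (x₀ x : M) : TangentSpace I x →L[ℝ] F :=
  (tangentCoordChange I x x₀ x : F →L[ℝ] F)

/-- The inverse of `chartD`. -/
def chartDInv (I : ModelWithCorners ℝ F H) [IsManifold I ∞ M] (x₀ x : M) :
    F →L[ℝ] TangentSpace I x :=
  (tangentCoordChange I x₀ x x : F →L[ℝ] F)

/-- The vector field `X` in the coordinates of the preferred chart at `x₀`. -/
def rep (x₀ : M) (X : VField I M) (z : F) : F :=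
  chartD I x₀ ((extChartAt I x₀).symm z) (X ((extChartAt I x₀).symm z))

variable {x₀ x : M}

theorem chartDInv_chartD (hx : x ∈ (extChartAt I x₀).source) (v : TangentSpace I x) :
    chartDInv I x₀ x (chartD I x₀ x v) = v := by
  have h := tangentCoordChange_comp (I := I) (w := x) (x := x₀) (y := x) (z := x) (v := v)
    ⟨⟨mem_extChartAt_source x, hx⟩, mem_extChartAt_source x⟩
  exact h.trans (tangentCoordChange_self (mem_extChartAt_source x))

theorem chartD_chartDInv (hx : x ∈ (extChartAt I x₀).source) (v : F) :
    chartD I x₀ x (chartDInv I x₀ x v) = v := by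
  have h := tangentCoordChange_comp (I := I) (w := x₀) (x := x) (y := x₀) (z := x) (v := v)
    ⟨⟨hx, mem_extChartAt_source x⟩, hx⟩
  exact h.trans (tangentCoordChange_self hx)

theorem chartD_injective (hx : x ∈ (extChartAt I x₀).source) :
    Function.Injective (chartD I x₀ x) := fun v w h => by
  rw [← chartDInv_chartD hx v, h, chartDInv_chartD hx]

theorem chartD_self (v : TangentSpace I x) : chartD I x x v = v :=
  tangentCoordChange_self (mem_extChartAt_source x)

theorem mfderiv_extChartAt_eq (hx : x ∈ (extChartAt I x₀).source) :
    mfderiv I 𝓘(ℝ, F) (extChartAt I x₀) x = chartD I x₀ x := by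
  have hx' : x ∈ (chartAt H x₀).source := by rwa [extChartAt_source] at hx
  have := mdifferentiableAt_extChartAt (I := I) hx'
  -- Both sides unfold to the derivative within `range I` of the change of charts; `mfderiv` only
  -- adds a differentiability test.
  exact if_pos this

theorem rep_apply (hx : x ∈ (extChartAt I x₀).source) (X : VField I M) :
    rep x₀ X (extChartAt I x₀ x) = chartD I x₀ x (X x) := by
  rw [rep, (extChartAt I x₀).left_inv hx]

theorem rep_comp_extChartAt (hx : x ∈ (extChartAt I x₀).source) (X : VField I M) :
    (fun y => (trivializationAt F (TangentSpace I) x₀ ⟨y, X y⟩).2) =ᶠ[𝓝 x]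
      rep x₀ X ∘ extChartAt I x₀ := by
  filter_upwards [extChartAt_source_mem_nhds' (I := I) hx] with y hy
  rw [Function.comp_apply, rep_apply hy]
  rfl

theorem rep_eq_comp_symm (X : VField I M) :
    rep x₀ X = (fun y => (trivializationAt F (TangentSpace I) x₀ ⟨y, X y⟩).2) ∘
      (extChartAt I x₀).symm := rfl

theorem along_eq (hx : x ∈ (extChartAt I x₀).source) (X : VField I M) {f : M → ℝ} {f' : F → ℝ}
    (hf : f ∘ (extChartAt I x₀).symm =ᶠ[𝓝 (extChartAt I x₀ x)] f')
    (hf' : DifferentiableAt ℝ f' (extChartAt I x₀ x)) :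
    along X f x = fderiv ℝ f' (extChartAt I x₀ x) (rep x₀ X (extChartAt I x₀ x)) := by
  have hx' : x ∈ (chartAt H x₀).source := by rwa [extChartAt_source] at hx
  have h : f =ᶠ[𝓝 x] f' ∘ extChartAt I x₀ := by
    filter_upwards [(continuousAt_extChartAt' (I := I) hx).eventually hf,
      extChartAt_source_mem_nhds' (I := I) hx] with y hy hys
    rw [Function.comp_apply, (extChartAt I x₀).left_inv hys] at hy
    exact hy
  rw [along, h.mfderiv_eq, mfderiv_comp (I' := 𝓘(ℝ, F)) x hf'.mdifferentiableAt
    (mdifferentiableAt_extChartAt hx'), mfderiv_extChartAt_eq hx, mfderiv_eq_fderiv, rep_apply hx]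
  rfl


theorem smoothFieldAt_iff [I.Boundaryless] (hx : x ∈ (extChartAt I x₀).source) {X : VField I M} :
    SmoothFieldAt X x ↔ ContDiffAt ℝ ∞ (rep x₀ X) (extChartAt I x₀ x) := by
  have hx' : x ∈ (chartAt H x₀).source := by rwa [extChartAt_source] at hx
  rw [SmoothFieldAt]
  have := (trivializationAt F (TangentSpace I) x₀).contMDiffAt_section_iff (IB := I) (n := ∞)
    (s := X) (x₀ := x) hx'
  rw [ModelWithCorners.tangent]
  refine this.trans ⟨fun h => ?_, fun h => ?_⟩
  · rw [← contMDiffAt_iff_contDiffAt, rep_eq_comp_symm]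
    refine ContMDiffAt.comp (I' := I) _ (by rwa [(extChartAt I x₀).left_inv hx]) ?_
    exact (contMDiffOn_extChartAt_symm x₀).contMDiffAt
      (extChartAt_target_mem_nhds' ((extChartAt I x₀).map_source hx))
  · refine ContMDiffAt.congr_of_eventuallyEq ?_ (rep_comp_extChartAt hx X)
    exact ContMDiffAt.comp _ h.contMDiffAt (contMDiffAt_extChartAt' hx')

theorem mdifferentiableAt_iff_rep [I.Boundaryless] (hx : x ∈ (extChartAt I x₀).source) {X : VField I M} :
    MDifferentiableAt I I.tangent (fun y => (⟨y, X y⟩ : TangentBundle I M)) x ↔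
      DifferentiableAt ℝ (rep x₀ X) (extChartAt I x₀ x) := by
  have hx' : x ∈ (chartAt H x₀).source := by rwa [extChartAt_source] at hx
  have := (trivializationAt F (TangentSpace I) x₀).mdifferentiableAt_section_iff (IB := I) 
    X (b₀ := x) hx'
  rw [ModelWithCorners.tangent]
  refine this.trans ⟨fun h => ?_, fun h => ?_⟩
  · rw [← mdifferentiableAt_iff_differentiableAt, rep_eq_comp_symm]
    refine MDifferentiableAt.comp (I' := I) _ (by rwa [(extChartAt I x₀).left_inv hx]) ?_
    exact ((contMDiffOn_extChartAt_symm (n := 1) x₀).contMDiffAt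
      (extChartAt_target_mem_nhds' ((extChartAt I x₀).map_source hx))).mdifferentiableAt
      one_ne_zero
  · refine MDifferentiableAt.congr_of_eventuallyEq ?_ (rep_comp_extChartAt hx X)
    exact MDifferentiableAt.comp _ h.mdifferentiableAt (mdifferentiableAt_extChartAt hx')

theorem SmoothField.contDiffOn_rep [I.Boundaryless] {X : VField I M} (hX : SmoothField X) (x₀ : M) :
    ContDiffOn ℝ ∞ (rep x₀ X) (extChartAt I x₀).target := fun z hz => by
  have h := (smoothFieldAt_iff ((extChartAt I x₀).map_target hz)).1 (hX.contMDiffAt)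
  rw [(extChartAt I x₀).right_inv hz] at h
  exact h.contDiffWithinAt

/-- `rep` as a vector field on the model space. -/
def repField (x₀ : M) (X : VField I M) : VField 𝓘(ℝ, F) F := fun z => (rep x₀ X z : F)

theorem mdifferentiableAt_repField {X : VField I M} {z : F}
    (hX : DifferentiableAt ℝ (rep x₀ X) z) :
    MDifferentiableAt 𝓘(ℝ, F) 𝓘(ℝ, F).tangent
      (fun z => (⟨z, repField x₀ X z⟩ : TangentBundle 𝓘(ℝ, F) F)) z := by
  rw [mdifferentiableAt_iff_rep (x₀ := z) (mem_extChartAt_source _)]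
  refine hX.congr_of_eventuallyEq (Eventually.of_forall fun z => ?_)
  exact congrArg (fun L : F →L[ℝ] F => L (rep x₀ X z))
    (tangentBundleCore_coordChange_model_space (I := 𝓘(ℝ, F)) _ _ z)

/-- Writes a field as a pullback from the model space, so that naturality of the bracket under
pullback applies. -/
theorem eventuallyEq_mpullback_repField (hx : x ∈ (extChartAt I x₀).source) (X : VField I M) :
    X =ᶠ[𝓝 x] mpullback I 𝓘(ℝ, F) (extChartAt I x₀) (repField x₀ X) := by
  filter_upwards [extChartAt_source_mem_nhds' (I := I) hx] with y hy
  have hi : ContinuousLinearMap.IsInvertible (mfderiv I 𝓘(ℝ, F) (extChartAt I x₀) y) :=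
    isInvertible_mfderiv_extChartAt hy
  have h := (hi.inverse_apply_eq (x := X y) (y := repField x₀ X (extChartAt I x₀ y))).2 (by
    rw [mfderiv_extChartAt_eq hy]; exact rep_apply hy X)
  exact h.symm

theorem chartD_mlieBracket [CompleteSpace F] (hx : x ∈ (extChartAt I x₀).source)
    {X Y : VField I M} (hX : DifferentiableAt ℝ (rep x₀ X) (extChartAt I x₀ x))
    (hY : DifferentiableAt ℝ (rep x₀ Y) (extChartAt I x₀ x)) :
    chartD I x₀ x (mlieBracket I X Y x) =
      lieBracket ℝ (rep x₀ X) (rep x₀ Y) (extChartAt I x₀ x) := by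
  have hx' : x ∈ (chartAt H x₀).source := by rwa [extChartAt_source] at hx
  have hm : IsManifold I (minSmoothness ℝ 2) M := by
    rw [minSmoothness_of_isRCLikeNormedField]; infer_instance
  have hm' : IsManifold 𝓘(ℝ, F) (minSmoothness ℝ 2) F := by
    rw [minSmoothness_of_isRCLikeNormedField]; infer_instance
  have hi : ContinuousLinearMap.IsInvertible (mfderiv I 𝓘(ℝ, F) (extChartAt I x₀) x) :=
      isInvertible_mfderiv_extChartAt hx
  have h2 : minSmoothness ℝ 2 ≤ ∞ := by
    rw [minSmoothness_of_isRCLikeNormedField]; exact WithTop.coe_le_coe.2 le_top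
  rw [(eventuallyEq_mpullback_repField hx X).mlieBracket_vectorField_eq
      (eventuallyEq_mpullback_repField hx Y),
    ← mpullback_mlieBracket (mdifferentiableAt_repField hX) (mdifferentiableAt_repField hY)
      (contMDiffAt_extChartAt' hx') h2,
    mpullback_apply, ← mfderiv_extChartAt_eq hx]
  refine (hi.inverse_apply_eq.1 rfl).symm.trans ?_
  rw [← mlieBracketWithin_univ, mlieBracketWithin_eq_lieBracketWithin]
  exact congrFun (lieBracketWithin_univ (𝕜 := ℝ) (V := rep x₀ X) (W := rep x₀ Y)) _

/-- Multiply the field with constant components in the chart at `x` by a bump function.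
Hausdorffness keeps the closed support of the bump inside the chart domain, so the extension by zero
is smooth. -/
theorem exists_smoothField [I.Boundaryless] [FiniteDimensional ℝ F] [T2Space M] (v : TangentSpace I x) :
    ∃ X : VField I M, SmoothField X ∧ X x = v := by
  obtain ⟨f⟩ : Nonempty (SmoothBumpFunction I x) := inferInstance
  set L : VField I M := fun y => chartDInv I x y v with hL
  have hLs : ∀ y ∈ (extChartAt I x).source, SmoothFieldAt L y := fun y hy => by
    rw [smoothFieldAt_iff hy]
    refine (contDiffAt_const (c := (id v : F))).congr_of_eventuallyEq ?_
    filter_upwards [extChartAt_target_mem_nhds' ((extChartAt I x).map_source hy)] with z hz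
    exact chartD_chartDInv ((extChartAt I x).map_target hz) _
  refine ⟨fun y => f y • L y, fun y => ?_, ?_⟩
  · by_cases hy : y ∈ tsupport f
    · exact f.contMDiffAt.smul_section (hLs y (f.tsupport_subset_extChartAt_source hy))
    · have h0 : (fun y => (⟨y, f y • L y⟩ : TangentBundle I M)) =ᶠ[𝓝 y]
          fun y => ⟨y, (0 : TangentSpace I y)⟩ := by
        filter_upwards [(isClosed_tsupport f).isOpen_compl.mem_nhds hy] with w hw
        rw [image_eq_zero_of_notMem_tsupport hw, zero_smul]
      exact (Bundle.contMDiffAt_zeroSection ℝ (TangentSpace I)).congr_of_eventuallyEq h0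
  · change f x • L x = v
    rw [f.eq_one, one_smul]
    exact chartD_self v

end Chart

/-! ### Christoffel symbols, connection forms and curvature on open sets of a vector space. -/

section Calculus

set_option maxSynthPendingDepth 3

variable {E F : Type*} [NormedAddCommGroup E] [NormedSpace ℝ E]
  [NormedAddCommGroup F] [NormedSpace ℝ F]

/-- `m` is a smooth Riemannian metric on the open subset `U` of the vector space `E`. -/
structure IsLocalMetric (U : Set E) (m : E → E →L[ℝ] E →L[ℝ] ℝ) : Prop where
  isOpen : IsOpen U
  contDiffOn : ContDiffOn ℝ ∞ m U
  symm : ∀ x ∈ U, ∀ a b, m x a b = m x b a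
  pos : ∀ x ∈ U, ∀ a, a ≠ 0 → 0 < m x a a

/-- Twice the Christoffel symbols of the first kind of `m`. -/
def christoffelForm (m : E → E →L[ℝ] E →L[ℝ] ℝ) (x : E) : E →L[ℝ] E →L[ℝ] E →L[ℝ] ℝ :=
  fderiv ℝ m x + (fderiv ℝ m x).flip -
    ((ContinuousLinearMap.flipₗᵢ ℝ E E ℝ).toContinuousLinearEquiv :
      (E →L[ℝ] E →L[ℝ] ℝ) →L[ℝ] (E →L[ℝ] E →L[ℝ] ℝ)) ∘L (fderiv ℝ m x).flip

/-- The Christoffel symbols (of the second kind) of `m`. -/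
def christ (m : E → E →L[ℝ] E →L[ℝ] ℝ) (x : E) : E →L[ℝ] E →L[ℝ] E :=
  (ContinuousLinearMap.compL ℝ E (E →L[ℝ] ℝ) E ((1 / 2 : ℝ) • (m x).inverse)) ∘L
    christoffelForm m x

/-- The Riemann curvature tensor of the connection with Christoffel symbols `Γ`. -/
def riemann (Γ : E → E →L[ℝ] E →L[ℝ] E) (x a b c : E) : E :=
  fderiv ℝ Γ x a b c - fderiv ℝ Γ x b a c + Γ x a (Γ x b c) - Γ x b (Γ x a c)

namespace IsLocalMetric

variable {U : Set E} {m : E → E →L[ℝ] E →L[ℝ] ℝ} (hm : IsLocalMetric U m) {x : E}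
include hm

theorem contDiffAt (hx : x ∈ U) : ContDiffAt ℝ ∞ m x :=
  hm.contDiffOn.contDiffAt (hm.isOpen.mem_nhds hx)

theorem differentiableAt (hx : x ∈ U) : DifferentiableAt ℝ m x :=
  (hm.contDiffAt hx).differentiableAt (by simp)

theorem ext (hx : x ∈ U) {v w : E} (h : ∀ c, m x v c = m x w c) : v = w := by
  by_contra hne
  have := hm.pos x hx (v - w) (sub_ne_zero.2 hne)
  rw [map_sub (m x), _root_.sub_apply, h, sub_self] at this
  exact this.false

theorem fderiv_symm (hx : x ∈ U) (a b c : E) : fderiv ℝ m x a b c = fderiv ℝ m x a c b := by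
  have hd := hm.differentiableAt hx
  have h : ∀ b c, fderiv ℝ m x a b c = fderiv ℝ (fun y => m y b c) x a := fun b c => by
    have h1 : HasFDerivAt (fun y => m y b c) _ x :=
      (hd.hasFDerivAt.clm_apply (hasFDerivAt_const b x)).clm_apply (hasFDerivAt_const c x)
    rw [h1.fderiv]; simp
  rw [h, h]
  congr 1
  refine Filter.EventuallyEq.fderiv_eq ?_
  filter_upwards [hm.isOpen.mem_nhds hx] with y hy using hm.symm y hy b c

theorem christoffelForm_apply (hx : x ∈ U) (a b c : E) : christoffelForm m x a b c =
    fderiv ℝ m x a b c + fderiv ℝ m x b c a - fderiv ℝ m x c a b := by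
  rw [hm.fderiv_symm hx b c a]
  rfl

variable [FiniteDimensional ℝ E]

/-- Positivity makes `m x` injective, and its target, the dual space, has the same finite dimension.
-/
theorem isInvertible (hx : x ∈ U) : (m x).IsInvertible := by
  have hinj : Function.Injective (m x : E →ₗ[ℝ] (E →L[ℝ] ℝ)) := fun v w h =>
    hm.ext hx fun c => congrArg (fun l : E →L[ℝ] ℝ => l c) h
  have hdim : Module.finrank ℝ E = Module.finrank ℝ (E →L[ℝ] ℝ) := by
    rw [← (LinearMap.toContinuousLinearMap (𝕜 := ℝ) (E := E) (F' := ℝ)).finrank_eq]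
    exact (Subspace.dual_finrank_eq (K := ℝ) (V := E)).symm
  exact ⟨(LinearMap.linearEquivOfInjective _ hinj hdim).toContinuousLinearEquiv, by ext; rfl⟩

/-- This is the Koszul formula for constant fields, whose brackets vanish. -/
theorem christ_spec (hx : x ∈ U) (a b c : E) : 2 * m x (christ m x a b) c =
    fderiv ℝ m x a b c + fderiv ℝ m x b c a - fderiv ℝ m x c a b := by
  have h : m x (christ m x a b) = (1 / 2 : ℝ) • christoffelForm m x a b := by
    change m x ((1 / 2 : ℝ) • (m x).inverse (christoffelForm m x a b)) = _
    rw [map_smul, ← (hm.isInvertible hx).inverse_apply_eq.1 rfl]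
  rw [h, ← hm.christoffelForm_apply hx, _root_.smul_apply, smul_eq_mul]
  ring

theorem christ_symm (hx : x ∈ U) (a b : E) : christ m x a b = christ m x b a := by
  refine hm.ext hx fun c => ?_
  have h1 := hm.christ_spec hx a b c
  have h2 := hm.christ_spec hx b a c
  rw [hm.fderiv_symm hx b a c, hm.fderiv_symm hx a c b, hm.fderiv_symm hx c b a] at h2
  linarith

/-- The derivative of `m` is smooth, and inversion of continuous linear maps is smooth at invertible
ones. -/
theorem contDiffOn_christ : ContDiffOn ℝ ∞ (christ m) U := by
  have hD : ContDiffOn ℝ ∞ (fderiv ℝ m) U :=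
    hm.contDiffOn.fderiv_of_isOpen hm.isOpen (by simp)
  have hflip : ContDiffOn ℝ ∞ (fun x => (fderiv ℝ m x).flip) U :=
    (ContinuousLinearMap.flipₗᵢ ℝ E E (E →L[ℝ] ℝ)).toContinuousLinearEquiv.contDiff.comp_contDiffOn
      hD
  have hinv : ContDiffOn ℝ ∞ (fun x => (1 / 2 : ℝ) • (m x).inverse) U := fun x hx => by
    obtain ⟨e, he⟩ := hm.isInvertible hx
    have := contDiffAt_map_inverse (𝕜 := ℝ) (n := ∞) e
    rw [he] at this
    exact ((this.comp x (hm.contDiffAt hx)).const_smul _).contDiffWithinAt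
  have h := ((ContinuousLinearMap.compL ℝ E (E →L[ℝ] ℝ) E).contDiff (n := ∞)).comp_contDiffOn hinv
  exact h.clm_comp ((hD.add hflip).sub (contDiffOn_const.clm_comp hflip))

theorem differentiableAt_christ (hx : x ∈ U) : DifferentiableAt ℝ (christ m) x :=
  ((hm.contDiffOn_christ.contDiffAt (hm.isOpen.mem_nhds hx))).differentiableAt (by simp)

end IsLocalMetric

/-- The covariant derivative `∂_X s + A(X) s` on a trivial bundle. -/
def covDeriv (A : F → F →L[ℝ] E →L[ℝ] E) (X : F → F) (s : F → E) (z : F) : E :=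
  fderiv ℝ s z (X z) + A z (X z) (s z)

theorem fderiv_covDeriv {A : F → F →L[ℝ] E →L[ℝ] E} {X : F → F} {s : F → E} {z : F}
    (hA : DifferentiableAt ℝ A z) (hX : DifferentiableAt ℝ X z) (hs : ContDiffAt ℝ 2 s z) (v : F) :
    fderiv ℝ (covDeriv A X s) z v = fderiv ℝ (fderiv ℝ s) z v (X z) + fderiv ℝ s z (fderiv ℝ X z v)
      + fderiv ℝ A z v (X z) (s z) + A z (fderiv ℝ X z v) (s z) + A z (X z) (fderiv ℝ s z v) := by
  have hs1 : DifferentiableAt ℝ s z := hs.differentiableAt (by simp)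
  have hs2 : DifferentiableAt ℝ (fderiv ℝ s) z :=
    (hs.fderiv_right (m := 1) (by norm_num)).differentiableAt (by simp)
  have h : HasFDerivAt (covDeriv A X s) _ z :=
    (hs2.hasFDerivAt.clm_apply hX.hasFDerivAt).add
      ((hA.hasFDerivAt.clm_apply hX.hasFDerivAt).clm_apply hs1.hasFDerivAt)
  rw [h.fderiv]
  simp
  abel

/-- Second derivatives of `s` cancel by symmetry, derivatives of `X` and `Y` cancel against the
bracket term, and the first-order terms in `s` cancel in pairs; dA + A∧A remains. -/
theorem covDeriv_curvature {A : F → F →L[ℝ] E →L[ℝ] E} {X Y : F → F} {s : F → E} {z : F}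
    (hA : DifferentiableAt ℝ A z) (hX : DifferentiableAt ℝ X z) (hY : DifferentiableAt ℝ Y z)
    (hs : ContDiffAt ℝ 2 s z) :
    covDeriv A X (covDeriv A Y s) z - covDeriv A Y (covDeriv A X s) z
        - covDeriv A (lieBracket ℝ X Y) s z =
      fderiv ℝ A z (X z) (Y z) (s z) - fderiv ℝ A z (Y z) (X z) (s z)
        + A z (X z) (A z (Y z) (s z)) - A z (Y z) (A z (X z) (s z)) := by
  have hsymm : fderiv ℝ (fderiv ℝ s) z (X z) (Y z) = fderiv ℝ (fderiv ℝ s) z (Y z) (X z) :=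
    (hs.isSymmSndFDerivAt (by simp)).eq _ _
  rw [covDeriv, covDeriv.eq_def A Y (covDeriv A X s), fderiv_covDeriv hA hY hs,
    fderiv_covDeriv hA hX hs, hsymm]
  simp only [covDeriv, lieBracket, map_sub, map_add, _root_.sub_apply]
  abel

/-- By the product rule every derivative of `a`, `b`, `c` cancels except that of `b` along `X`,
which occurs twice. The directions `X`, `Y`, `Z` are kept separate from the fibre components `a`,
`b`, `c`, so that the identity serves the base as well as both distributions on TN. -/
theorem koszul_identity {m : F → E →L[ℝ] E →L[ℝ] ℝ} {X Y Z : F → F} {a b c : F → E} {z : F}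
    (hm : DifferentiableAt ℝ m z) (hsymm : ∀ v w, m z v w = m z w v)
    (ha : DifferentiableAt ℝ a z) (hb : DifferentiableAt ℝ b z) (hc : DifferentiableAt ℝ c z) :
    fderiv ℝ (fun y => m y (b y) (c y)) z (X z) + fderiv ℝ (fun y => m y (c y) (a y)) z (Y z)
      - fderiv ℝ (fun y => m y (a y) (b y)) z (Z z)
      + m z (fderiv ℝ b z (X z) - fderiv ℝ a z (Y z)) (c z)
      - m z (fderiv ℝ c z (Y z) - fderiv ℝ b z (Z z)) (a z)
      + m z (fderiv ℝ a z (Z z) - fderiv ℝ c z (X z)) (b z) =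
    2 * m z (fderiv ℝ b z (X z)) (c z) + (fderiv ℝ m z (X z) (b z) (c z)
      + fderiv ℝ m z (Y z) (c z) (a z) - fderiv ℝ m z (Z z) (a z) (b z)) := by
  have h : ∀ {b c : F → E}, DifferentiableAt ℝ b z → DifferentiableAt ℝ c z → ∀ v,
      fderiv ℝ (fun y => m y (b y) (c y)) z v = fderiv ℝ m z v (b z) (c z)
        + m z (fderiv ℝ b z v) (c z) + m z (b z) (fderiv ℝ c z v) := fun {b c} hb hc v => by
    have h : HasFDerivAt (fun y => m y (b y) (c y)) _ z :=
      (hm.hasFDerivAt.clm_apply hb.hasFDerivAt).clm_apply hc.hasFDerivAt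
    rw [h.fderiv]
    simp
    ring
  rw [h hb hc, h hc ha, h ha hb]
  simp only [map_sub, _root_.sub_apply]
  rw [hsymm (b z) (fderiv ℝ c z (X z)), hsymm (c z) (fderiv ℝ a z (Y z)),
    hsymm (a z) (fderiv ℝ b z (Z z))]
  ring

end Calculus

/-! ### The Koszul formula on a distribution, evaluated in a chart. -/

section KoszulChart

variable {E F H M : Type*} [NormedAddCommGroup E] [NormedSpace ℝ E]
  [NormedAddCommGroup F] [NormedSpace ℝ F] [TopologicalSpace H]
  {I : ModelWithCorners ℝ F H} [TopologicalSpace M] [ChartedSpace H M] [IsManifold I ∞ M]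
  {x₀ x : M}

theorem exists_smoothFieldAt [I.Boundaryless] (v : TangentSpace I x) :
    ∃ X : VField I M, SmoothFieldAt X x ∧ X x = v := by
  refine ⟨fun y => chartDInv I x y v, ?_, chartD_self v⟩
  rw [smoothFieldAt_iff (mem_extChartAt_source x)]
  refine (contDiffAt_const (c := (id v : F))).congr_of_eventuallyEq ?_
  filter_upwards [extChartAt_target_mem_nhds (I := I) x] with z hz
  exact chartD_chartDInv ((extChartAt I x).map_target hz) _

/-- Replaces the choice in the definition by any candidate satisfying the formula, once the metric
separates vectors of the distribution. -/
theorem koszulDeriv_eq [I.Boundaryless] {G : Pairing I M} {W : Form I M} {Q : Endo I M}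
    {X Y : VField I M} {v : TangentSpace I x} (hv : Q x v = v)
    (hspec : ∀ Z : VField I M, SmoothFieldAt Z x →
      2 * G x v (Q x (Z x)) = koszul G W Q (Q.app X) (Q.app Y) (Q.app Z) x)
    (huniq : ∀ w, Q x w = w → (∀ ξ, G x w (Q x ξ) = G x v (Q x ξ)) → w = v) :
    koszulDeriv G W Q X Y x = v := by
  have h : ∃ v : TangentSpace I x, Q x v = v ∧ ∀ Z : VField I M, SmoothFieldAt Z x →
        2 * G x v (Q x (Z x)) = koszul G W Q (Q.app X) (Q.app Y) (Q.app Z) x := ⟨v, hv, hspec⟩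
  rw [koszulDeriv, dif_pos h]
  -- The formula only tests values `Z x` of fields smooth near `x`; every `ξ` is such a value.
  refine huniq _ h.choose_spec.1 fun ξ => ?_
  obtain ⟨Z, hZ, rfl⟩ := exists_smoothFieldAt ξ
  have := (h.choose_spec.2 Z hZ).trans (hspec Z hZ).symm
  linarith

/-- The `E`-valued function given by the vector field `X` and the fibrewise map `κ`, in the chart
at `x₀`. -/
def fibreRep (x₀ : M) (κ : (y : M) → TangentSpace I y → E) (X : VField I M) (z : F) : E :=
  κ ((extChartAt I x₀).symm z) (X ((extChartAt I x₀).symm z))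

theorem fibreRep_apply (hx : x ∈ (extChartAt I x₀).source) (κ : (y : M) → TangentSpace I y → E)
    (X : VField I M) : fibreRep x₀ κ X (extChartAt I x₀ x) = κ x (X x) := by
  rw [fibreRep, (extChartAt I x₀).left_inv hx]

/-- Evaluation of `koszulDeriv` in a chart, when the distribution `im Q` is identified near `x`
with the trivial bundle with fibre `E` by fibrewise maps `κ`. -/
theorem koszulDeriv_eq_of_chart [I.Boundaryless] [CompleteSpace F]
    {G : Pairing I M} {W : Form I M} {Q : Endo I M} {X Y : VField I M} {v : TangentSpace I x}
    (hx : x ∈ (extChartAt I x₀).source)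
    (κ : (y : M) → TangentSpace I y → E) (m : F → E →L[ℝ] E →L[ℝ] ℝ) (θ : E → ℝ)
    (hm : DifferentiableAt ℝ m (extChartAt I x₀ x))
    (hsymm : ∀ a b, m (extChartAt I x₀ x) a b = m (extChartAt I x₀ x) b a)
    (hnd : ∀ a b, (∀ c, m (extChartAt I x₀ x) a c = m (extChartAt I x₀ x) b c) → a = b)
    (hsurj : ∀ e, ∃ ξ, κ x (Q x ξ) = e)
    (hinj : ∀ ξ η, Q x ξ = ξ → Q x η = η → κ x ξ = κ x η → ξ = η)
    (hG : ∀ y ∈ (extChartAt I x₀).source, ∀ ξ η, G y (Q y ξ) (Q y η) =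
      m (extChartAt I x₀ y) (κ y (Q y ξ)) (κ y (Q y η)))
    (hW : ∀ ξ, W x (Q x ξ) = θ (κ x (Q x ξ)))
    (hdiff : ∀ X : VField I M, DifferentiableAt ℝ (rep x₀ X) (extChartAt I x₀ x) →
      DifferentiableAt ℝ (fibreRep x₀ κ (Q.app X)) (extChartAt I x₀ x))
    (hbr : ∀ X Y : VField I M, DifferentiableAt ℝ (rep x₀ X) (extChartAt I x₀ x) →
      DifferentiableAt ℝ (rep x₀ Y) (extChartAt I x₀ x) →
      κ x (Q x (mlieBracket I (Q.app X) (Q.app Y) x)) =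
        fderiv ℝ (fibreRep x₀ κ (Q.app Y))
          (extChartAt I x₀ x) (rep x₀ (Q.app X) (extChartAt I x₀ x)) -
        fderiv ℝ (fibreRep x₀ κ (Q.app X))
          (extChartAt I x₀ x) (rep x₀ (Q.app Y) (extChartAt I x₀ x)))
    (hX : DifferentiableAt ℝ (rep x₀ X) (extChartAt I x₀ x))
    (hY : DifferentiableAt ℝ (rep x₀ Y) (extChartAt I x₀ x))
    (hv : Q x v = v)
    (hvspec : ∀ ξ, 2 * m (extChartAt I x₀ x) (κ x v) (κ x (Q x ξ)) =
      2 * m (extChartAt I x₀ x) (fderiv ℝ (fibreRep x₀ κ (Q.app Y)) (extChartAt I x₀ x)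
          (rep x₀ (Q.app X) (extChartAt I x₀ x))) (κ x (Q x ξ))
      + (fderiv ℝ m (extChartAt I x₀ x) (chartD I x₀ x (Q x (X x)))
          (κ x (Q x (Y x))) (κ x (Q x ξ))
        + fderiv ℝ m (extChartAt I x₀ x) (chartD I x₀ x (Q x (Y x)))
          (κ x (Q x ξ)) (κ x (Q x (X x)))
        - fderiv ℝ m (extChartAt I x₀ x) (chartD I x₀ x (Q x ξ))
          (κ x (Q x (X x))) (κ x (Q x (Y x))))
      + θ (κ x (Q x (X x))) * m (extChartAt I x₀ x) (κ x (Q x (Y x))) (κ x (Q x ξ))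
      + θ (κ x (Q x (Y x))) * m (extChartAt I x₀ x) (κ x (Q x ξ)) (κ x (Q x (X x)))
      - θ (κ x (Q x ξ)) * m (extChartAt I x₀ x) (κ x (Q x (X x))) (κ x (Q x (Y x)))) :
    koszulDeriv G W Q X Y x = v := by
  have hGv : ∀ w ξ, Q x w = w → G x w (Q x ξ) = m (extChartAt I x₀ x) (κ x w) (κ x (Q x ξ)) := by
    intro w ξ hw
    have := hG x hx w ξ
    rwa [hw] at this
  refine koszulDeriv_eq hv (fun Z hZ => ?_) fun w hw h => ?_
  · have hZ' : DifferentiableAt ℝ (rep x₀ Z) (extChartAt I x₀ x) :=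
      ((smoothFieldAt_iff hx).1 hZ).differentiableAt (by simp)
    have hal : ∀ X Y Z : VField I M, DifferentiableAt ℝ (rep x₀ Y) (extChartAt I x₀ x) →
        DifferentiableAt ℝ (rep x₀ Z) (extChartAt I x₀ x) →
        along X (fun y => G y (Q.app Y y) (Q.app Z y)) x =
          fderiv ℝ (fun z => m z (fibreRep x₀ κ (Q.app Y) z) (fibreRep x₀ κ (Q.app Z) z)) (extChartAt I x₀ x)
            (rep x₀ X (extChartAt I x₀ x)) := fun X Y Z hY hZ => by
      refine along_eq hx X ?_ ((hm.clm_apply (hdiff Y hY)).clm_apply (hdiff Z hZ))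
      filter_upwards [extChartAt_target_mem_nhds' ((extChartAt I x₀).map_source hx)] with z hz
      have := hG ((extChartAt I x₀).symm z) ((extChartAt I x₀).map_target hz)
        (Y ((extChartAt I x₀).symm z)) (Z ((extChartAt I x₀).symm z))
      rwa [(extChartAt I x₀).right_inv hz] at this
    have hGx : ∀ ξ η, G x (Q x ξ) (Q x η) = _ := hG x hx
    have key := koszul_identity (X := rep x₀ (Q.app X)) (Y := rep x₀ (Q.app Y))
      (Z := rep x₀ (Q.app Z)) hm hsymm (hdiff X hX) (hdiff Y hY) (hdiff Z hZ')
    rw [hGv v _ hv, hvspec (Z x), koszul, hal _ _ _ hY hZ', hal _ _ _ hZ' hX, hal _ _ _ hX hY]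
    simp only [fibreRep_apply hx, rep_apply hx] at key hbr ⊢
    simp only [show ∀ X : VField I M, Q.app X x = Q x (X x) from fun _ => rfl] at key hbr ⊢
    rw [hGx, hGx, hGx, hGx, hGx, hGx, hW, hW, hW, hbr X Y hX hY, hbr Y Z hY hZ', hbr Z X hZ' hX]
    linarith
  · refine hinj _ _ hw hv (hnd _ _ fun c => ?_)
    obtain ⟨ξ, rfl⟩ := hsurj c
    rw [← hGv w ξ hw, ← hGv v ξ hv, h]

end KoszulChart

/-! ### The base manifold: metric, Levi-Civita connection and curvature in coordinates. -/

section Base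

set_option maxSynthPendingDepth 3

variable {n : ℕ} {N : Type*} [TopologicalSpace N] [ChartedSpace (EuclideanSpace ℝ (Fin n)) N]
  [IsManifold (𝓡 n) ∞ N] (g : Metric n N) {p₀ p : N}

/-- The metric `g` in the coordinates of the preferred chart at `p₀`. -/
def coordMetric (p₀ : N) (x : EuclideanSpace ℝ (Fin n)) :
    EuclideanSpace ℝ (Fin n) →L[ℝ] EuclideanSpace ℝ (Fin n) →L[ℝ] ℝ :=
  ContinuousLinearMap.bilinearComp
    (show EuclideanSpace ℝ (Fin n) →L[ℝ] EuclideanSpace ℝ (Fin n) →L[ℝ] ℝ from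
      g.inner ((extChartAt (𝓡 n) p₀).symm x))
    (chartDInv (𝓡 n) p₀ ((extChartAt (𝓡 n) p₀).symm x))
    (chartDInv (𝓡 n) p₀ ((extChartAt (𝓡 n) p₀).symm x))

theorem coordMetric_eq (x a b : EuclideanSpace ℝ (Fin n)) : coordMetric g p₀ x a b =
    g.inner ((extChartAt (𝓡 n) p₀).symm x) (chartDInv (𝓡 n) p₀ ((extChartAt (𝓡 n) p₀).symm x) a)
      (chartDInv (𝓡 n) p₀ ((extChartAt (𝓡 n) p₀).symm x) b) := rfl

theorem coordMetric_chartD (hp : p ∈ (extChartAt (𝓡 n) p₀).source) (v w : TangentSpace (𝓡 n) p) :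
    coordMetric g p₀ (extChartAt (𝓡 n) p₀ p) (chartD (𝓡 n) p₀ p v) (chartD (𝓡 n) p₀ p w) =
      g.inner p v w := by
  rw [coordMetric_eq, (extChartAt (𝓡 n) p₀).left_inv hp, chartDInv_chartD hp, chartDInv_chartD hp]

theorem isLocalMetric_coordMetric (p₀ : N) :
    IsLocalMetric (extChartAt (𝓡 n) p₀).target (coordMetric g p₀) where
  isOpen := isOpen_extChartAt_target p₀
  symm x _ a b := by
    rw [coordMetric_eq, coordMetric_eq]
    exact g.symm _ _ _
  pos x hx a ha := by
    rw [coordMetric_eq]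
    refine g.pos _ _ fun h => ha ?_
    rw [← chartD_chartDInv ((extChartAt (𝓡 n) p₀).map_target hx) a, h, map_zero]
  contDiffOn := by
    -- In finite dimension it suffices to evaluate at fixed `a` and `b`, that is, to apply `g` to
    -- two fields with constant components in the chart at `p₀`.
    refine contDiffOn_clm_apply.2 fun a => contDiffOn_clm_apply.2 fun b => fun x hx => ?_
    have hp := (extChartAt (𝓡 n) p₀).map_target hx
    have hL : ∀ a : EuclideanSpace ℝ (Fin n),
        SmoothFieldAt (I := 𝓡 n) (fun q : N => chartDInv (𝓡 n) p₀ q a)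
          ((extChartAt (𝓡 n) p₀).symm x) := fun a => by
      rw [smoothFieldAt_iff hp]
      refine (contDiffAt_const (c := a)).congr_of_eventuallyEq ?_
      filter_upwards [extChartAt_target_mem_nhds' ((extChartAt (𝓡 n) p₀).map_source hp)] with z hz
      exact chartD_chartDInv ((extChartAt (𝓡 n) p₀).map_target hz) _
    have h1 : ContMDiffAt (𝓡 n) ((𝓡 n).prod 𝓘(ℝ, ℝ)) ∞
        (fun q : N => Bundle.TotalSpace.mk' ℝ (E := Bundle.Trivial N ℝ) q
          (g.inner q (chartDInv (𝓡 n) p₀ q a) (chartDInv (𝓡 n) p₀ q b)))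
          ((extChartAt (𝓡 n) p₀).symm x) := by
      apply ContMDiffAt.clm_bundle_apply₂ (F₁ := EuclideanSpace ℝ (Fin n))
        (F₂ := EuclideanSpace ℝ (Fin n))
      · exact g.contMDiff.contMDiffAt
      · exact hL a
      · exact hL b
    rw [Bundle.contMDiffAt_totalSpace] at h1
    have h2 := h1.2.comp x ((contMDiffOn_extChartAt_symm p₀).contMDiffAt
      (extChartAt_target_mem_nhds' (I := 𝓡 n) (x := p₀) hx))
    exact h2.contDiffAt.contDiffWithinAt

/-- The case of `koszulDeriv_eq_of_chart` where the distribution is the whole tangent bundle,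
identified with the model space by the chart, and the 1-form is zero; `christ_spec` is then the
required formula. -/
theorem chartD_leviCivita (hp : p ∈ (extChartAt (𝓡 n) p₀).source) {X Y : VField (𝓡 n) N}
    (hX : DifferentiableAt ℝ (rep p₀ X) (extChartAt (𝓡 n) p₀ p))
    (hY : DifferentiableAt ℝ (rep p₀ Y) (extChartAt (𝓡 n) p₀ p)) :
    chartD (𝓡 n) p₀ p (leviCivita g X Y p) =
      covDeriv (christ (coordMetric g p₀)) (rep p₀ X) (rep p₀ Y) (extChartAt (𝓡 n) p₀ p) := by
  have hm := isLocalMetric_coordMetric g p₀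
  have hx := (extChartAt (𝓡 n) p₀).map_source hp
  have key : leviCivita g X Y p = chartDInv (𝓡 n) p₀ p
      (covDeriv (christ (coordMetric g p₀)) (rep p₀ X) (rep p₀ Y) (extChartAt (𝓡 n) p₀ p)) := by
    refine koszulDeriv_eq_of_chart (x₀ := p₀) hp (fun y v => chartD (𝓡 n) p₀ y v)
      (coordMetric g p₀) (fun _ => 0) (hm.differentiableAt hx) (hm.symm _ hx)
      (fun a b => hm.ext hx) (fun e => ⟨_, chartD_chartDInv hp e⟩)
      (fun ξ η _ _ h => chartD_injective hp h)
      (fun y hy ξ η => (coordMetric_chartD g hy ξ η).symm) (fun _ => rfl) (fun X hX => hX)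
      (fun X Y hX hY => chartD_mlieBracket hp hX hY) hX hY rfl fun ξ => ?_
    have hs := hm.christ_spec hx (chartD (𝓡 n) p₀ p (X p)) (chartD (𝓡 n) p₀ p (Y p))
      (chartD (𝓡 n) p₀ p ξ)
    rw [chartD_chartDInv hp, covDeriv, map_add, _root_.add_apply, mul_add, rep_apply hp,
      rep_apply hp, hs]
    simp only [zero_mul, add_zero, sub_zero]
    congr 4
    change fderiv ℝ (rep p₀ Y) _ _ = fderiv ℝ (rep p₀ Y) _ (rep p₀ X _)
    rw [rep_apply hp]
  rw [key, chartD_chartDInv hp]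

theorem contDiffOn_covDeriv {E F : Type*} [NormedAddCommGroup E] [NormedSpace ℝ E]
    [NormedAddCommGroup F] [NormedSpace ℝ F] {U : Set F} (hU : IsOpen U)
    {A : F → F →L[ℝ] E →L[ℝ] E} {X : F → F} {s : F → E} (hA : ContDiffOn ℝ ∞ A U)
    (hX : ContDiffOn ℝ ∞ X U) (hs : ContDiffOn ℝ ∞ s U) : ContDiffOn ℝ ∞ (covDeriv A X s) U :=
  ((hs.fderiv_of_isOpen hU (by simp)).clm_apply hX).add ((hA.clm_apply hX).clm_apply hs)

theorem contDiffOn_lieBracket {F : Type*} [NormedAddCommGroup F] [NormedSpace ℝ F] {U : Set F}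
    (hU : IsOpen U) {X Y : F → F} (hX : ContDiffOn ℝ ∞ X U) (hY : ContDiffOn ℝ ∞ Y U) :
    ContDiffOn ℝ ∞ (lieBracket ℝ X Y) U :=
  ((hY.fderiv_of_isOpen hU (by simp)).clm_apply hX).sub
    ((hX.fderiv_of_isOpen hU (by simp)).clm_apply hY)

theorem covDeriv_congr {E F : Type*} [NormedAddCommGroup E] [NormedSpace ℝ E]
    [NormedAddCommGroup F] [NormedSpace ℝ F] {A : F → F →L[ℝ] E →L[ℝ] E} {X Y : F → F}
    {s t : F → E} {z : F} (hX : X z = Y z) (hs : s =ᶠ[𝓝 z] t) :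
    covDeriv A X s z = covDeriv A Y t z := by
  rw [covDeriv, covDeriv, hX, hs.fderiv_eq, hs.eq_of_nhds]

theorem rep_mlieBracket {F H M : Type*} [NormedAddCommGroup F] [NormedSpace ℝ F]
    [CompleteSpace F] [TopologicalSpace H] {I : ModelWithCorners ℝ F H} [I.Boundaryless]
    [TopologicalSpace M] [ChartedSpace H M] [IsManifold I ∞ M] {x₀ : M} {X Y : VField I M}
    (hX : ContDiffOn ℝ ∞ (rep x₀ X) (extChartAt I x₀).target)
    (hY : ContDiffOn ℝ ∞ (rep x₀ Y) (extChartAt I x₀).target) {z : F}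
    (hz : z ∈ (extChartAt I x₀).target) :
    rep x₀ (mlieBracket I X Y) z = lieBracket ℝ (rep x₀ X) (rep x₀ Y) z := by
  have hU := (isOpen_extChartAt_target (I := I) x₀).mem_nhds hz
  have hs := (extChartAt I x₀).map_target hz
  have hr := (extChartAt I x₀).right_inv hz
  have := chartD_mlieBracket hs (X := X) (Y := Y)
    (by rw [hr]; exact (hX.contDiffAt hU).differentiableAt (by simp))
    (by rw [hr]; exact (hY.contDiffAt hU).differentiableAt (by simp))
  rwa [hr] at this

theorem rep_leviCivita {X Y : VField (𝓡 n) N}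
    (hX : ContDiffOn ℝ ∞ (rep p₀ X) (extChartAt (𝓡 n) p₀).target)
    (hY : ContDiffOn ℝ ∞ (rep p₀ Y) (extChartAt (𝓡 n) p₀).target)
    {x : EuclideanSpace ℝ (Fin n)} (hx : x ∈ (extChartAt (𝓡 n) p₀).target) :
    rep p₀ (leviCivita g X Y) x =
      covDeriv (christ (coordMetric g p₀)) (rep p₀ X) (rep p₀ Y) x := by
  have hU := (isOpen_extChartAt_target (I := 𝓡 n) p₀).mem_nhds hx
  have hs := (extChartAt (𝓡 n) p₀).map_target hx
  have hr := (extChartAt (𝓡 n) p₀).right_inv hx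
  have := chartD_leviCivita g hs (X := X) (Y := Y)
    (by rw [hr]; exact (hX.contDiffAt hU).differentiableAt (by simp))
    (by rw [hr]; exact (hY.contDiffAt hU).differentiableAt (by simp))
  rwa [hr] at this

/-- The curvature of the connection form `A`. -/
def formCurvature {E F : Type*} [NormedAddCommGroup E] [NormedSpace ℝ E]
    [NormedAddCommGroup F] [NormedSpace ℝ F] (A : F → F →L[ℝ] E →L[ℝ] E) (z v w : F) (c : E) : E :=
  fderiv ℝ A z v w c - fderiv ℝ A z w v c + A z v (A z w c) - A z w (A z v c)

/-- The curvature of an operator `D` on vector fields is given, in fibre components `r` in which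
`D` acts through the connection form `A`, by the curvature of `A`. -/
theorem curvature_of_eqOn_covDeriv {E F H M : Type*} [NormedAddCommGroup E] [NormedSpace ℝ E]
    [NormedAddCommGroup F] [NormedSpace ℝ F]
    [CompleteSpace F] [TopologicalSpace H] {I : ModelWithCorners ℝ F H} [I.Boundaryless]
    [TopologicalSpace M] [ChartedSpace H M] [IsManifold I ∞ M] {x₀ : M}
    {D : VField I M → VField I M → VField I M} {r : VField I M → F → E}
    {A : F → F →L[ℝ] E →L[ℝ] E} (hA : ContDiffOn ℝ ∞ A (extChartAt I x₀).target)
    (hr : ∀ X, ContDiffOn ℝ ∞ (rep x₀ X) (extChartAt I x₀).target →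
      ContDiffOn ℝ ∞ (r X) (extChartAt I x₀).target)
    (hD : ∀ X Y, ContDiffOn ℝ ∞ (rep x₀ X) (extChartAt I x₀).target →
      ContDiffOn ℝ ∞ (rep x₀ Y) (extChartAt I x₀).target →
      ContDiffOn ℝ ∞ (rep x₀ (D X Y)) (extChartAt I x₀).target)
    (h : ∀ X Y, ContDiffOn ℝ ∞ (rep x₀ X) (extChartAt I x₀).target →
      ContDiffOn ℝ ∞ (rep x₀ Y) (extChartAt I x₀).target →
      EqOn (r (D X Y)) (covDeriv A (rep x₀ X) (r Y)) (extChartAt I x₀).target)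
    {X Y Z : VField I M} (hX : ContDiffOn ℝ ∞ (rep x₀ X) (extChartAt I x₀).target)
    (hY : ContDiffOn ℝ ∞ (rep x₀ Y) (extChartAt I x₀).target)
    (hZ : ContDiffOn ℝ ∞ (rep x₀ Z) (extChartAt I x₀).target) {z : F}
    (hz : z ∈ (extChartAt I x₀).target) :
    r (D X (D Y Z)) z - r (D Y (D X Z)) z - r (D (mlieBracket I X Y) Z) z =
      formCurvature A z (rep x₀ X z) (rep x₀ Y z) (r Z z) := by
  have hO := isOpen_extChartAt_target (I := I) x₀
  have hU := hO.mem_nhds hz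
  have h1 : ∀ X Y : VField I M, ContDiffOn ℝ ∞ (rep x₀ X) (extChartAt I x₀).target →
      ContDiffOn ℝ ∞ (rep x₀ Y) (extChartAt I x₀).target →
      r (D X (D Y Z)) z = covDeriv A (rep x₀ X) (covDeriv A (rep x₀ Y) (r Z)) z :=
    fun X Y hX hY => (h X _ hX (hD Y Z hY hZ) hz).trans
      (covDeriv_congr rfl ((h Y Z hY hZ).eventuallyEq_of_mem hU))
  have e : EqOn (rep x₀ (mlieBracket I X Y)) (lieBracket ℝ (rep x₀ X) (rep x₀ Y))
    (extChartAt I x₀).target := fun z hz => rep_mlieBracket hX hY hz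
  have h2 : r (D (mlieBracket I X Y) Z) z = covDeriv A (lieBracket ℝ (rep x₀ X) (rep x₀ Y)) (r Z) z :=
    (h _ Z ((contDiffOn_lieBracket hO hX hY).congr e) hZ hz).trans
      (covDeriv_congr (e hz) (Filter.EventuallyEq.refl _ _))
  rw [h1 X Y hX hY, h1 Y X hY hX, h2]
  exact covDeriv_curvature ((hA.contDiffAt hU).differentiableAt (by simp))
    ((hX.contDiffAt hU).differentiableAt (by simp)) ((hY.contDiffAt hU).differentiableAt (by simp))
    (((hr Z hZ).contDiffAt hU).of_le (by exact WithTop.coe_le_coe.2 le_top))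

theorem chartD_curvature_leviCivita {X Y Z : VField (𝓡 n) N} (hX : SmoothField X)
    (hY : SmoothField Y) (hZ : SmoothField Z) (p : N) :
    chartD (𝓡 n) p p (curvature (leviCivita g) X Y Z p) =
      riemann (christ (coordMetric g p)) (extChartAt (𝓡 n) p p) (X p) (Y p) (Z p) := by
  have hm := isLocalMetric_coordMetric g p
  have hp := mem_extChartAt_source (I := 𝓡 n) p
  have key := curvature_of_eqOn_covDeriv (D := leviCivita g) (r := rep p) hm.contDiffOn_christ
    (fun X hX => hX) (fun X Y hX hY => (contDiffOn_covDeriv hm.isOpen hm.contDiffOn_christ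
      hX hY).congr fun x hx => rep_leviCivita g hX hY hx)
    (fun X Y hX hY x hx => rep_leviCivita g hX hY hx)
    (hX.contDiffOn_rep p) (hY.contDiffOn_rep p) (hZ.contDiffOn_rep p) (mem_extChartAt_target p)
  simp only [rep_apply hp] at key
  rw [curvature, map_sub, map_sub, key, chartD_self, chartD_self, chartD_self]
  rfl

/-- Each triple of vectors at `p` is the value of global smooth fields, so flatness can be tested on
coordinate vectors at the centre of each preferred chart. -/
theorem isFlat_iff [T2Space N] : IsFlat g ↔ ∀ (p : N) (a b c : EuclideanSpace ℝ (Fin n)),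
    riemann (christ (coordMetric g p)) (extChartAt (𝓡 n) p p) a b c = 0 := by
  refine ⟨fun h p a b c => ?_, fun h X Y Z hX hY hZ p => ?_⟩
  · obtain ⟨X, hX, rfl⟩ := exists_smoothField (I := 𝓡 n) (x := p) a
    obtain ⟨Y, hY, rfl⟩ := exists_smoothField (I := 𝓡 n) (x := p) b
    obtain ⟨Z, hZ, rfl⟩ := exists_smoothField (I := 𝓡 n) (x := p) c
    rw [← chartD_curvature_leviCivita g hX hY hZ p, h X Y Z hX hY hZ p, map_zero]
  · refine chartD_injective (mem_extChartAt_source p) ?_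
    rw [chartD_curvature_leviCivita g hX hY hZ]
    exact (h p _ _ _).trans (map_zero _).symm

end Base

/-! ### Induced charts of the tangent bundle and their coordinate changes. -/

section TangentChart

variable {F H M : Type*} [NormedAddCommGroup F] [NormedSpace ℝ F] [TopologicalSpace H]
  {I : ModelWithCorners ℝ F H} [TopologicalSpace M] [ChartedSpace H M] [IsManifold I ∞ M]

theorem mem_extChartAt_tangent_source {u₀ u : TangentBundle I M} :
    u ∈ (extChartAt I.tangent u₀).source ↔ u.proj ∈ (extChartAt I u₀.proj).source := by
  rw [extChartAt_source, extChartAt_source, TangentBundle.mem_chart_source_iff]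

theorem extChartAt_tangent_target (u₀ : TangentBundle I M) :
    (extChartAt I.tangent u₀).target = (extChartAt I u₀.proj).target ×ˢ univ := by
  refine (FiberBundle.extChartAt_target (IB := I) u₀).trans ?_
  congr 1
  refine inter_eq_left.2 fun z hz => ?_
  have := (extChartAt I u₀.proj).map_target hz
  rwa [extChartAt_source] at this

theorem extChartAt_tangent_apply (u₀ u : TangentBundle I M) :
    extChartAt I.tangent u₀ u =
      (extChartAt I u₀.proj u.proj, chartD I u₀.proj u.proj u.snd) := rfl

theorem extChartAt_tangent_symm {u₀ : TangentBundle I M} {z : F × F}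
    (hz : z.1 ∈ (extChartAt I u₀.proj).target) :
    (extChartAt I.tangent u₀).symm z = ⟨(extChartAt I u₀.proj).symm z.1,
      chartDInv I u₀.proj ((extChartAt I u₀.proj).symm z.1) z.2⟩ := by
  have hz' : z ∈ (extChartAt I.tangent u₀).target := by
    rw [extChartAt_tangent_target]; exact ⟨hz, mem_univ _⟩
  have hs := (extChartAt I u₀.proj).map_target hz
  refine (extChartAt I.tangent u₀).injOn ((extChartAt I.tangent u₀).map_target hz')
    (mem_extChartAt_tangent_source.2 hs) ?_
  rw [(extChartAt I.tangent u₀).right_inv hz', extChartAt_tangent_apply]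
  simp only [chartD_chartDInv hs, (extChartAt I u₀.proj).right_inv hz]

theorem extend_eq_chartDInv {p q : M} (hq : q ∈ (extChartAt I p).source) (v : TangentSpace I p) :
    FiberBundle.extend F v q = chartDInv I p q v := by
  have hq' : q ∈ (chartAt H p).source := by rwa [extChartAt_source] at hq
  have h1 : (trivializationAt F (TangentSpace I) p ⟨p, v⟩).2 = v := chartD_self v
  have h2 := congrArg (fun L : F →L[ℝ] F => L v)
    (TangentBundle.symmL_trivializationAt_eq_core (𝕜 := ℝ) (I := I) hq')
  rw [FiberBundle.extend]
  have h3 := Bundle.Trivialization.symmL_apply (R := ℝ) (trivializationAt F (TangentSpace I) p)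
    (b := q) hq' v
  exact (congrArg _ h1).trans (h3.symm.trans h2)

theorem chartD_chartDInv_eq {p₀ p q : M} (hp : q ∈ (extChartAt I p).source)
    (hp₀ : q ∈ (extChartAt I p₀).source) (v : F) :
    chartD I p₀ q (chartDInv I p q v) = tangentCoordChange I p p₀ q v :=
  tangentCoordChange_comp ⟨⟨hp, mem_extChartAt_source q⟩, hp₀⟩

theorem contDiffAt_rep_extend [I.Boundaryless] {p₀ p : M} (hp : p ∈ (extChartAt I p₀).source)
    (v : TangentSpace I p) :
    ContDiffAt ℝ ∞ (rep p₀ (fun q => FiberBundle.extend F v q)) (extChartAt I p₀ p) := by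
  rw [← smoothFieldAt_iff hp, smoothFieldAt_iff (mem_extChartAt_source p)]
  refine (contDiffAt_const (c := (id v : F))).congr_of_eventuallyEq ?_
  filter_upwards [extChartAt_target_mem_nhds (I := I) p] with z hz
  have hs := (extChartAt I p).map_target hz
  rw [rep, extend_eq_chartDInv hs]
  exact chartD_chartDInv hs _

/-- With τ the change of charts of the base, that of TN is (x, y) ↦ (τ(x), Dτ(x)y), with derivative
(a, b) ↦ (Dτ a, D²τ(a, y) + Dτ b). The second-order term is written as the derivative of the
chart-constant extension of y, the form in which it also occurs in `chartD_christoffel`. -/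
theorem chartD_tangent [I.Boundaryless] {u₀ u : TangentBundle I M}
    (hu : u.proj ∈ (extChartAt I u₀.proj).source) (ξ : TangentSpace I.tangent u) :
    chartD I.tangent u₀ u ξ = (chartD I u₀.proj u.proj ξ.1,
      fderiv ℝ (rep u₀.proj (fun q => FiberBundle.extend F u.snd q)) (extChartAt I u₀.proj u.proj)
        (chartD I u₀.proj u.proj ξ.1) + chartD I u₀.proj u.proj ξ.2) := by
  set p := u.proj with hpdef
  set p₀ := u₀.proj
  set x := extChartAt I p p with hxdef
  set y : F := u.snd with hy
  have hpp : p ∈ (extChartAt I p).source := mem_extChartAt_source p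
  have hsymm : (extChartAt I p).symm x = p := (extChartAt I p).left_inv hpp
  have hev : ∀ᶠ x' in 𝓝 x, x' ∈ (extChartAt I p).target ∧
      (extChartAt I p).symm x' ∈ (extChartAt I p₀).source := by
    refine Filter.Eventually.and (extChartAt_target_mem_nhds (I := I) p) ?_
    refine (continuousAt_extChartAt_symm (I := I) p).eventually ?_
    rw [hsymm]
    exact extChartAt_source_mem_nhds' hu
  set T : F → F →L[ℝ] F := fun x' => tangentCoordChange I p p₀ ((extChartAt I p).symm x') with hT
  have hτ : HasFDerivAt (extChartAt I p₀ ∘ (extChartAt I p).symm)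
      (tangentCoordChange I p p₀ p) x := by
    have := hasFDerivWithinAt_tangentCoordChange (I := I) (x := p) (y := p₀) (z := p) ⟨hpp, hu⟩
    rwa [I.range_eq_univ, hasFDerivWithinAt_univ] at this
  -- Dτ applied to a fixed `v` is the field with constant components `v` in the chart at `p`, read
  -- in the chart at `p₀`.
  have hRT : ∀ v : F, (fun x' => T x' v) =ᶠ[𝓝 x]
      rep p₀ (fun q => FiberBundle.extend F (show TangentSpace I p from v) q) ∘
        (extChartAt I p₀ ∘ (extChartAt I p).symm) := fun v => by
    filter_upwards [hev] with x' hx'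
    have hs := (extChartAt I p).map_target hx'.1
    rw [Function.comp_apply, Function.comp_apply, rep_apply hx'.2, extend_eq_chartDInv hs]
    exact (chartD_chartDInv_eq hs hx'.2 v).symm
  have hτx : (extChartAt I p₀ ∘ (extChartAt I p).symm) x = extChartAt I p₀ p := by
    rw [Function.comp_apply, hsymm]
  have hRd : ∀ v : F, HasFDerivAt (fun x' => T x' v)
      ((fderiv ℝ (rep p₀ (fun q => FiberBundle.extend F (show TangentSpace I p from v) q))
        (extChartAt I p₀ p)).comp (tangentCoordChange I p p₀ p)) x := fun v => by
    refine HasFDerivAt.congr_of_eventuallyEq (HasFDerivAt.comp x ?_ hτ) (hRT v)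
    rw [hτx]
    exact ((contDiffAt_rep_extend hu _).differentiableAt (by simp)).hasFDerivAt
  -- Near `x`, `T` is the derivative of the smooth map τ.
  have hTd : DifferentiableAt ℝ T x := by
    have h1 : ContDiffAt ℝ 1 (fderiv ℝ (extChartAt I p₀ ∘ (extChartAt I p).symm)) x := by
      have h2 : ContDiffWithinAt ℝ 2 (extChartAt I p₀ ∘ (extChartAt I p).symm) (range I) x := by
        refine contDiffWithinAt_ext_coord_change p₀ p ?_
        rw [PartialEquiv.trans_source, PartialEquiv.symm_source]
        exact hev.self_of_nhds
      rw [I.range_eq_univ, contDiffWithinAt_univ] at h2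
      exact h2.fderiv_right (by norm_num)
    refine (h1.differentiableAt (by simp)).congr_of_eventuallyEq ?_
    filter_upwards [hev] with x' hx'
    have := tangentCoordChange_def (I := I) (x := p) (y := p₀) (z := (extChartAt I p).symm x')
    rwa [I.range_eq_univ, fderivWithin_univ, (extChartAt I p).right_inv hx'.1] at this
  have hD : HasFDerivAt (fun z : F × F => ((extChartAt I p₀ ∘ (extChartAt I p).symm) z.1, T z.1 z.2))
      _ (x, y) :=
    (HasFDerivAt.comp (g := extChartAt I p₀ ∘ (extChartAt I p).symm) (x, y) hτ
      hasFDerivAt_fst).prodMk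
      ((HasFDerivAt.comp (g := T) (x, y) hTd.hasFDerivAt hasFDerivAt_fst).clm_apply
        hasFDerivAt_snd)
  have hux : extChartAt I.tangent u u = (x, y) := by
    rw [extChartAt_tangent_apply]
    exact congrArg (Prod.mk x) (chartD_self u.snd)
  have hD' : HasFDerivAt (extChartAt I.tangent u₀ ∘ (extChartAt I.tangent u).symm)
      (tangentCoordChange I.tangent u u₀ u) (x, y) := by
    have := hasFDerivWithinAt_tangentCoordChange (I := I.tangent) (x := u) (y := u₀) (z := u)
      ⟨mem_extChartAt_source u, mem_extChartAt_tangent_source.2 hu⟩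
    rwa [I.tangent.range_eq_univ, hasFDerivWithinAt_univ, hux] at this
  have heq : extChartAt I.tangent u₀ ∘ (extChartAt I.tangent u).symm =ᶠ[𝓝 (x, y)]
      fun z : F × F => ((extChartAt I p₀ ∘ (extChartAt I p).symm) z.1, T z.1 z.2) := by
    filter_upwards [continuousAt_fst.eventually hev] with z hz
    have hs := (extChartAt I p).map_target hz.1
    rw [Function.comp_apply, extChartAt_tangent_symm hz.1, extChartAt_tangent_apply]
    exact congrArg (Prod.mk _) (chartD_chartDInv_eq hs hz.2 z.2)
  have hfin := congrArg (fun L : F × F →L[ℝ] F × F => L ξ)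
    (hD'.unique (hD.congr_of_eventuallyEq heq))
  refine hfin.trans (Prod.ext rfl ?_)
  -- Two computations of the derivative of `T · y` at `x`: through `T` itself and through the
  -- constant extension of `y`.
  have hTy := congrArg (fun L : F →L[ℝ] F => L ξ.1)
    (((hTd.hasFDerivAt.clm_apply (hasFDerivAt_const y x))).unique (hRd y))
  have hTx : T x = tangentCoordChange I p p₀ p := by rw [hT]; simp only [hsymm]
  simp only [_root_.add_apply, ContinuousLinearMap.comp_apply, ContinuousLinearMap.flip_apply] at hTy
  rw [_root_.zero_apply, map_zero, zero_add] at hTy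
  change T x ξ.2 + fderiv ℝ T x ξ.1 y = _
  rw [hTx, add_comm, hTy]
  rfl

/-- Points over different base points are separated by the projection, points of one fibre by a
local trivialization. This permits bump functions on TN. -/
theorem t2Space_tangentBundle [T2Space M] : T2Space (TangentBundle I M) := by
  refine ⟨fun u v huv => ?_⟩
  by_cases h : u.proj = v.proj
  · let e := trivializationAt F (TangentSpace I) u.proj
    have hu : u ∈ e.source := FiberBundle.mem_trivializationAt_proj_source
    have hv : v ∈ e.source := by rw [e.mem_source, ← h]; exact e.mem_source.1 hu
    have hne : (e u).2 ≠ (e v).2 := fun he => huv <| e.injOn hu hv <|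
      Prod.ext ((e.coe_fst hu).trans (h.trans (e.coe_fst hv).symm)) he
    obtain ⟨A, B, hA, hB, huA, hvB, hAB⟩ := t2_separation hne
    refine ⟨e.source ∩ (fun w => (e w).2) ⁻¹' A, e.source ∩ (fun w => (e w).2) ⁻¹' B,
      ?_, ?_, ⟨hu, huA⟩, ⟨hv, hvB⟩, ?_⟩
    · exact (continuous_snd.comp_continuousOn e.continuousOn).isOpen_inter_preimage e.open_source hA
    · exact (continuous_snd.comp_continuousOn e.continuousOn).isOpen_inter_preimage e.open_source hB
    · exact (hAB.preimage (fun w => (e w).2)).mono inter_subset_right inter_subset_right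
  · exact separated_by_continuous (FiberBundle.continuous_proj F (TangentSpace I)) h

end TangentChart

/-! ### Horizontal and vertical components; the Sasaki metric and the Cartan form. -/

section Sasaki

set_option maxSynthPendingDepth 3

variable {n : ℕ} {N : Type*} [TopologicalSpace N] [ChartedSpace (EuclideanSpace ℝ (Fin n)) N]
  [IsManifold (𝓡 n) ∞ N] (g : Metric n N) {u₀ u : TangentBundle (𝓡 n) N}

/-- The transformation law of the Christoffel symbols, with its inhomogeneous term as the derivative
of the extension of `w`. -/
theorem chartD_christoffel {p₀ p : N} (hp : p ∈ (extChartAt (𝓡 n) p₀).source)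
    (v w : TangentSpace (𝓡 n) p) :
    chartD (𝓡 n) p₀ p (christoffel g p v w) =
      fderiv ℝ (rep p₀ (fun q => FiberBundle.extend (EuclideanSpace ℝ (Fin n)) w q))
        (extChartAt (𝓡 n) p₀ p) (chartD (𝓡 n) p₀ p v) +
      christ (coordMetric g p₀) (extChartAt (𝓡 n) p₀ p) (chartD (𝓡 n) p₀ p v)
        (chartD (𝓡 n) p₀ p w) := by
  rw [christoffel, chartD_leviCivita g hp
    ((contDiffAt_rep_extend hp v).differentiableAt (by simp))
    ((contDiffAt_rep_extend hp w).differentiableAt (by simp)), covDeriv, rep_apply hp,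
    rep_apply hp, FiberBundle.extend_apply_self, FiberBundle.extend_apply_self]

theorem chartD_tangent_fst (hu : u.proj ∈ (extChartAt (𝓡 n) u₀.proj).source)
    (ξ : TangentSpace (𝓡 n).tangent u) :
    (chartD (𝓡 n).tangent u₀ u ξ).1 = chartD (𝓡 n) u₀.proj u.proj ξ.1 := by
  rw [chartD_tangent hu]

/-- The inhomogeneous terms of `chartD_tangent` and `chartD_christoffel` cancel, so δ/δx has the
same expression in every induced chart. -/
theorem chartD_hor (hu : u.proj ∈ (extChartAt (𝓡 n) u₀.proj).source)
    (ξ : TangentSpace (𝓡 n).tangent u) :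
    chartD (𝓡 n).tangent u₀ u (hor g u ξ) = ((chartD (𝓡 n).tangent u₀ u ξ).1,
      -christ (coordMetric g u₀.proj) (extChartAt (𝓡 n) u₀.proj u.proj)
        (chartD (𝓡 n).tangent u₀ u ξ).1 (chartD (𝓡 n) u₀.proj u.proj u.snd)) := by
  rw [chartD_tangent hu, chartD_tangent hu]
  refine Prod.ext rfl ?_
  have h := chartD_christoffel g hu ξ.1 u.snd
  have h' : chartD (𝓡 n) u₀.proj u.proj (-christoffel g u.proj ξ.1 u.snd) = _ :=
    (map_neg _ _).trans (congrArg Neg.neg h)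
  change fderiv ℝ _ _ (chartD (𝓡 n) u₀.proj u.proj ξ.1) +
    chartD (𝓡 n) u₀.proj u.proj (-christoffel g u.proj ξ.1 u.snd) = _
  rw [h', neg_add, add_neg_cancel_left]

/-- The fibre coordinate of the vertical part `b + Γ(a, y)` of a tangent vector `(a, b)` at
`(x, y)`, in the chart at `u₀`. -/
def vertComp (u₀ u : TangentBundle (𝓡 n) N) (ξ : TangentSpace (𝓡 n).tangent u) :
    EuclideanSpace ℝ (Fin n) :=
  (chartD (𝓡 n).tangent u₀ u ξ).2 + christ (coordMetric g u₀.proj)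
    (extChartAt (𝓡 n) u₀.proj u.proj) (chartD (𝓡 n).tangent u₀ u ξ).1
    (chartD (𝓡 n) u₀.proj u.proj u.snd)

/-- The horizontal coordinate `a` of a tangent vector `(a, b)`, in the chart at `u₀`. -/
def horComp (u₀ u : TangentBundle (𝓡 n) N) (ξ : TangentSpace (𝓡 n).tangent u) :
    EuclideanSpace ℝ (Fin n) :=
  (chartD (𝓡 n).tangent u₀ u ξ).1

theorem chartD_vert (hu : u.proj ∈ (extChartAt (𝓡 n) u₀.proj).source)
    (ξ : TangentSpace (𝓡 n).tangent u) :
    chartD (𝓡 n).tangent u₀ u (vert g u ξ) = (0, vertComp g u₀ u ξ) := by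
  rw [vert, map_sub, chartD_hor g hu, vertComp]
  refine Prod.ext (sub_self _) ?_
  exact sub_neg_eq_add _ _

theorem horComp_hor (hu : u.proj ∈ (extChartAt (𝓡 n) u₀.proj).source)
    (ξ : TangentSpace (𝓡 n).tangent u) : horComp u₀ u (hor g u ξ) = horComp u₀ u ξ := by
  rw [horComp, chartD_hor g hu, horComp]

theorem horComp_vert (hu : u.proj ∈ (extChartAt (𝓡 n) u₀.proj).source)
    (ξ : TangentSpace (𝓡 n).tangent u) : horComp u₀ u (vert g u ξ) = 0 := by
  rw [horComp, chartD_vert g hu]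

theorem vertComp_hor (hu : u.proj ∈ (extChartAt (𝓡 n) u₀.proj).source)
    (ξ : TangentSpace (𝓡 n).tangent u) : vertComp g u₀ u (hor g u ξ) = 0 := by
  rw [vertComp, chartD_hor g hu, neg_add_cancel]

theorem vertComp_vert (hu : u.proj ∈ (extChartAt (𝓡 n) u₀.proj).source)
    (ξ : TangentSpace (𝓡 n).tangent u) : vertComp g u₀ u (vert g u ξ) = vertComp g u₀ u ξ := by
  rw [vertComp, chartD_vert g hu]
  simp

theorem horComp_add (ξ η : TangentSpace (𝓡 n).tangent u) :
    horComp u₀ u (ξ + η) = horComp u₀ u ξ + horComp u₀ u η := by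
  rw [horComp, map_add]; rfl

theorem horComp_sub (ξ η : TangentSpace (𝓡 n).tangent u) :
    horComp u₀ u (ξ - η) = horComp u₀ u ξ - horComp u₀ u η := by
  rw [horComp, map_sub]; rfl

theorem vertComp_add (ξ η : TangentSpace (𝓡 n).tangent u) :
    vertComp g u₀ u (ξ + η) = vertComp g u₀ u ξ + vertComp g u₀ u η := by
  simp only [vertComp, map_add, Prod.fst_add, Prod.snd_add, _root_.add_apply]
  abel

theorem vertComp_sub (ξ η : TangentSpace (𝓡 n).tangent u) :
    vertComp g u₀ u (ξ - η) = vertComp g u₀ u ξ - vertComp g u₀ u η := by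
  simp only [vertComp, map_sub, Prod.fst_sub, Prod.snd_sub, _root_.sub_apply]
  abel

theorem ext_comp (hu : u.proj ∈ (extChartAt (𝓡 n) u₀.proj).source)
    {ξ η : TangentSpace (𝓡 n).tangent u} (h : horComp u₀ u ξ = horComp u₀ u η)
    (h' : vertComp g u₀ u ξ = vertComp g u₀ u η) : ξ = η := by
  refine chartD_injective (mem_extChartAt_tangent_source.2 hu) ?_
  rw [horComp, horComp] at h
  rw [vertComp, vertComp, h, add_left_inj] at h'
  exact Prod.ext h h'

theorem exists_comp_eq (hu : u.proj ∈ (extChartAt (𝓡 n) u₀.proj).source)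
    (a b : EuclideanSpace ℝ (Fin n)) :
    ∃ ξ : TangentSpace (𝓡 n).tangent u, horComp u₀ u ξ = a ∧ vertComp g u₀ u ξ = b := by
  refine ⟨chartDInv (𝓡 n).tangent u₀ u (a, b - christ (coordMetric g u₀.proj)
    (extChartAt (𝓡 n) u₀.proj u.proj) a (chartD (𝓡 n) u₀.proj u.proj u.snd)), ?_, ?_⟩
  · rw [horComp, chartD_chartDInv (mem_extChartAt_tangent_source.2 hu)]
  · rw [vertComp, chartD_chartDInv (mem_extChartAt_tangent_source.2 hu), sub_add_cancel]

theorem hor_eq_self_iff {ξ : TangentSpace (𝓡 n).tangent u}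
    (hu : u.proj ∈ (extChartAt (𝓡 n) u₀.proj).source) :
    hor g u ξ = ξ ↔ vertComp g u₀ u ξ = 0 := by
  refine ⟨fun h => by rw [← h, vertComp_hor g hu], fun h => ext_comp g hu (horComp_hor g hu ξ) ?_⟩
  rw [vertComp_hor g hu, h]

theorem vert_eq_self_iff {ξ : TangentSpace (𝓡 n).tangent u}
    (hu : u.proj ∈ (extChartAt (𝓡 n) u₀.proj).source) :
    vert g u ξ = ξ ↔ horComp u₀ u ξ = 0 := by
  refine ⟨fun h => by rw [← h, horComp_vert g hu], fun h => ext_comp g hu ?_ (vertComp_vert g hu ξ)⟩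
  rw [horComp_vert g hu, h]

theorem sasaki_eq (hu : u.proj ∈ (extChartAt (𝓡 n) u₀.proj).source)
    (ξ η : TangentSpace (𝓡 n).tangent u) : sasaki g u ξ η =
      coordMetric g u₀.proj (extChartAt (𝓡 n) u₀.proj u.proj) (horComp u₀ u ξ) (horComp u₀ u η) +
      coordMetric g u₀.proj (extChartAt (𝓡 n) u₀.proj u.proj) (vertComp g u₀ u ξ)
        (vertComp g u₀ u η) := by
  have hv : ∀ ξ : TangentSpace (𝓡 n).tangent u,
      chartD (𝓡 n) u₀.proj u.proj (vert g u ξ).2 = vertComp g u₀ u ξ := fun ξ => by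
    have h1 := congrArg Prod.fst (chartD_vert g hu ξ)
    have h2 := congrArg Prod.snd (chartD_vert g hu ξ)
    rw [chartD_tangent hu] at h1 h2
    simp only at h1 h2
    rwa [h1, map_zero, zero_add] at h2
  have h1 := coordMetric_chartD g hu ξ.1 η.1
  have h2 := coordMetric_chartD g hu (vert g u ξ).2 (vert g u η).2
  rw [hv, hv] at h2
  rw [horComp, horComp, chartD_tangent_fst hu, chartD_tangent_fst hu]
  exact (congrArg₂ (· + ·) h1 h2).symm

/-- Along the line y + ta in a fibre, F² is a quadratic polynomial in t with linear coefficient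
2g(y, a); hence θ(ξ) = g(y, a). -/
theorem cartanForm_eq (hu : u.proj ∈ (extChartAt (𝓡 n) u₀.proj).source)
    (ξ : TangentSpace (𝓡 n).tangent u) : cartanForm g u ξ =
      coordMetric g u₀.proj (extChartAt (𝓡 n) u₀.proj u.proj)
        (chartD (𝓡 n) u₀.proj u.proj u.snd) (horComp u₀ u ξ) := by
  rw [horComp, chartD_tangent_fst hu]
  refine Eq.trans ?_ (coordMetric_chartD g hu u.snd ξ.1).symm
  set a : TangentSpace (𝓡 n) u.proj := ξ.1 with ha
  have hsq : ∀ t : ℝ, finslerF g ⟨u.proj, u.snd + t • a⟩ ^ 2 =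
      g.inner u.proj u.snd u.snd + t * (2 * g.inner u.proj u.snd a)
        + t ^ 2 * g.inner u.proj a a := fun t => by
    have hnn : ∀ v : TangentSpace (𝓡 n) u.proj, 0 ≤ g.inner u.proj v v := fun v => by
      rcases eq_or_ne v 0 with rfl | hv
      · simp
      · exact (g.pos _ v hv).le
    rw [finslerF, Real.sq_sqrt (hnn _)]
    have hs := g.symm u.proj a u.snd
    simp only [map_add, map_smul, _root_.add_apply, _root_.smul_apply, smul_eq_mul]
    rw [hs]
    ring
  have hd : HasDerivAt (fun t : ℝ => finslerF g ⟨u.proj, u.snd + t • a⟩ ^ 2)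
      (2 * g.inner u.proj u.snd a) 0 := by
    simp only [hsq]
    have h1 := ((hasDerivAt_id (0 : ℝ)).mul_const (2 * g.inner u.proj u.snd a)).const_add
      (g.inner u.proj u.snd u.snd)
    have h2 := ((hasDerivAt_id (0 : ℝ)).pow 2).mul_const (g.inner u.proj a a)
    exact (h1.add h2).congr_deriv (by simp)
  rw [cartanForm]
  have := hd.deriv
  refine (congrArg (fun r => (1 / 2 : ℝ) * r) this).trans (by ring)

end Sasaki

/-! ### The connection forms of the vertical and horizontal parts. -/

section ConnectionForms

set_option maxSynthPendingDepth 3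

variable {E : Type*} [NormedAddCommGroup E] [NormedSpace ℝ E]

/-- The connection form on `U × E` of the vertical part of the Vranceanu–Cartan connection:
the pullback of the Christoffel symbols. -/
def vertForm (Γ : E → E →L[ℝ] E →L[ℝ] E) (z : E × E) : E × E →L[ℝ] E →L[ℝ] E :=
  (Γ z.1).comp (ContinuousLinearMap.fst ℝ E E)

/-- The symbols `½ (θ(a) c + θ(c) a - m(a, c) y)` at `(x, y)`, where `θ = m(y, ·)`. -/
def weylSymbol (m : E → E →L[ℝ] E →L[ℝ] ℝ) (z : E × E) : E →L[ℝ] E →L[ℝ] E :=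
  (1 / 2 : ℝ) • ((m z.1 z.2).smulRight (ContinuousLinearMap.id ℝ E) +
    ((m z.1 z.2).smulRight (ContinuousLinearMap.id ℝ E)).flip -
    ((ContinuousLinearMap.smulRightL ℝ E E).flip z.2).comp (m z.1))

/-- The connection form on `U × E` of the horizontal part of the Vranceanu–Cartan connection. -/
def horForm (m : E → E →L[ℝ] E →L[ℝ] ℝ) (z : E × E) : E × E →L[ℝ] E →L[ℝ] E :=
  (christ m z.1 + weylSymbol m z).comp (ContinuousLinearMap.fst ℝ E E)

theorem vertForm_apply (Γ : E → E →L[ℝ] E →L[ℝ] E) (z ξ : E × E) (c : E) :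
    vertForm Γ z ξ c = Γ z.1 ξ.1 c := rfl

theorem weylSymbol_apply (m : E → E →L[ℝ] E →L[ℝ] ℝ) (z : E × E) (a c : E) :
    weylSymbol m z a c =
      (1 / 2 : ℝ) • (m z.1 z.2 a • c + m z.1 z.2 c • a - m z.1 a c • z.2) := rfl

theorem horForm_apply (m : E → E →L[ℝ] E →L[ℝ] ℝ) (z ξ : E × E) (c : E) :
    horForm m z ξ c = christ m z.1 ξ.1 c + weylSymbol m z ξ.1 c := rfl

variable {U : Set E} {m : E → E →L[ℝ] E →L[ℝ] ℝ}

theorem IsLocalMetric.contDiffOn_vertForm [FiniteDimensional ℝ E] (hm : IsLocalMetric U m) :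
    ContDiffOn ℝ ∞ (vertForm (christ m)) (U ×ˢ univ) :=
  (hm.contDiffOn_christ.comp contDiffOn_fst fun _ hz => hz.1).clm_comp contDiffOn_const

theorem IsLocalMetric.contDiffOn_weylSymbol [FiniteDimensional ℝ E] (hm : IsLocalMetric U m) :
    ContDiffOn ℝ ∞ (weylSymbol m) (U ×ˢ univ) := by
  refine contDiffOn_clm_apply.2 fun a => contDiffOn_clm_apply.2 fun c => ?_
  simp only [weylSymbol_apply]
  have h1 : ContDiffOn ℝ ∞ (fun z : E × E => m z.1) (U ×ˢ univ) :=
    hm.contDiffOn.comp contDiffOn_fst fun _ hz => hz.1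
  have h2 := h1.clm_apply (contDiffOn_snd (E := E) (F := E))
  exact ((((h2.clm_apply contDiffOn_const).smul contDiffOn_const).add
    ((h2.clm_apply contDiffOn_const).smul contDiffOn_const)).sub
    (((h1.clm_apply contDiffOn_const).clm_apply contDiffOn_const).smul contDiffOn_snd)).const_smul _

theorem IsLocalMetric.contDiffOn_horForm [FiniteDimensional ℝ E] (hm : IsLocalMetric U m) :
    ContDiffOn ℝ ∞ (horForm m) (U ×ˢ univ) :=
  ((hm.contDiffOn_christ.comp contDiffOn_fst fun _ hz => hz.1).add
    hm.contDiffOn_weylSymbol).clm_comp contDiffOn_const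

end ConnectionForms

/-! ### Vector fields on TN and their brackets in adapted components. -/

section Connection

set_option maxSynthPendingDepth 3

variable {n : ℕ} {N : Type*} [TopologicalSpace N] [ChartedSpace (EuclideanSpace ℝ (Fin n)) N]
  [IsManifold (𝓡 n) ∞ N] (g : Metric n N) {u₀ u : TangentBundle (𝓡 n) N}

/-- The horizontal components of a vector field on `TN` in the chart at `u₀`. -/
abbrev horRep (u₀ : TangentBundle (𝓡 n) N)
    (X : VField (𝓡 n).tangent (TangentBundle (𝓡 n) N)) :
    EuclideanSpace ℝ (Fin n) × EuclideanSpace ℝ (Fin n) → EuclideanSpace ℝ (Fin n) :=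
  fibreRep u₀ (horComp u₀) X

/-- The vertical components of a vector field on `TN` in the chart at `u₀`. -/
abbrev vertRep (u₀ : TangentBundle (𝓡 n) N)
    (X : VField (𝓡 n).tangent (TangentBundle (𝓡 n) N)) :
    EuclideanSpace ℝ (Fin n) × EuclideanSpace ℝ (Fin n) → EuclideanSpace ℝ (Fin n) :=
  fibreRep u₀ (vertComp g u₀) X

variable {X Y : VField (𝓡 n).tangent (TangentBundle (𝓡 n) N)}
  {z : EuclideanSpace ℝ (Fin n) × EuclideanSpace ℝ (Fin n)}

theorem proj_symm_mem (hz : z ∈ (extChartAt (𝓡 n).tangent u₀).target) :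
    ((extChartAt (𝓡 n).tangent u₀).symm z).proj ∈ (extChartAt (𝓡 n) u₀.proj).source :=
  mem_extChartAt_tangent_source.1 ((extChartAt (𝓡 n).tangent u₀).map_target hz)

theorem horRep_eq : horRep u₀ X z = (rep u₀ X z).1 := rfl

theorem vertRep_eq (hz : z ∈ (extChartAt (𝓡 n).tangent u₀).target) :
    vertRep g u₀ X z = (rep u₀ X z).2 +
      christ (coordMetric g u₀.proj) z.1 (rep u₀ X z).1 z.2 := by
  have h := extChartAt_tangent_apply u₀ ((extChartAt (𝓡 n).tangent u₀).symm z)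
  rw [(extChartAt (𝓡 n).tangent u₀).right_inv hz] at h
  have h1 := congrArg Prod.fst h
  have h2 := congrArg Prod.snd h
  simp only at h1 h2
  rw [h1, h2]
  rfl

theorem rep_eq (hz : z ∈ (extChartAt (𝓡 n).tangent u₀).target) :
    rep u₀ X z = (horRep u₀ X z, vertRep g u₀ X z -
      christ (coordMetric g u₀.proj) z.1 (horRep u₀ X z) z.2) := by
  rw [vertRep_eq g hz]
  exact Prod.ext rfl (add_sub_cancel_right _ _).symm

theorem horRep_hor (hz : z ∈ (extChartAt (𝓡 n).tangent u₀).target) :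
    horRep u₀ ((hor g).app X) z = horRep u₀ X z :=
  horComp_hor g (proj_symm_mem hz) _

theorem horRep_vert (hz : z ∈ (extChartAt (𝓡 n).tangent u₀).target) :
    horRep u₀ ((vert g).app X) z = 0 :=
  horComp_vert g (proj_symm_mem hz) _

theorem vertRep_hor (hz : z ∈ (extChartAt (𝓡 n).tangent u₀).target) :
    vertRep g u₀ ((hor g).app X) z = 0 :=
  vertComp_hor g (proj_symm_mem hz) _

theorem vertRep_vert (hz : z ∈ (extChartAt (𝓡 n).tangent u₀).target) :
    vertRep g u₀ ((vert g).app X) z = vertRep g u₀ X z :=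
  vertComp_vert g (proj_symm_mem hz) _

theorem rep_hor_add_rep_vert :
    rep u₀ ((hor g).app X) z + rep u₀ ((vert g).app X) z = rep u₀ X z := by
  rw [rep, rep, ← map_add]
  exact congrArg _ (add_sub_cancel _ _)

theorem isOpen_tangent_target : IsOpen (extChartAt (𝓡 n).tangent u₀).target :=
  isOpen_extChartAt_target u₀

theorem fst_mem_target (hz : z ∈ (extChartAt (𝓡 n).tangent u₀).target) :
    z.1 ∈ (extChartAt (𝓡 n) u₀.proj).target := by
  rw [extChartAt_tangent_target] at hz
  exact hz.1

theorem differentiableAt_christ_fst (hz : z ∈ (extChartAt (𝓡 n).tangent u₀).target) :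
    DifferentiableAt ℝ (fun z : EuclideanSpace ℝ (Fin n) × EuclideanSpace ℝ (Fin n) =>
      christ (coordMetric g u₀.proj) z.1) z :=
  DifferentiableAt.comp z ((isLocalMetric_coordMetric g u₀.proj).differentiableAt_christ
    (fst_mem_target hz)) differentiableAt_fst

theorem differentiableAt_horRep (hX : DifferentiableAt ℝ (rep u₀ X) z) :
    DifferentiableAt ℝ (horRep u₀ X) z :=
  DifferentiableAt.comp z differentiableAt_fst hX

theorem differentiableAt_vertRep (hz : z ∈ (extChartAt (𝓡 n).tangent u₀).target)
    (hX : DifferentiableAt ℝ (rep u₀ X) z) : DifferentiableAt ℝ (vertRep g u₀ X) z := by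
  have h1 : DifferentiableAt ℝ (fun z => (rep u₀ X z).1) z :=
    DifferentiableAt.comp z differentiableAt_fst hX
  have h2 : DifferentiableAt ℝ (fun z => (rep u₀ X z).2) z :=
    DifferentiableAt.comp z differentiableAt_snd hX
  refine (h2.add (((differentiableAt_christ_fst g hz).clm_apply h1).clm_apply
    differentiableAt_snd)).congr_of_eventuallyEq ?_
  filter_upwards [isOpen_tangent_target.mem_nhds hz] with w hw using vertRep_eq g hw

theorem differentiableAt_rep_of_comp (hz : z ∈ (extChartAt (𝓡 n).tangent u₀).target)
    (h : DifferentiableAt ℝ (horRep u₀ X) z) (h' : DifferentiableAt ℝ (vertRep g u₀ X) z) :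
    DifferentiableAt ℝ (rep u₀ X) z := by
  refine (h.prodMk (h'.sub (((differentiableAt_christ_fst g hz).clm_apply h).clm_apply
    differentiableAt_snd))).congr_of_eventuallyEq ?_
  filter_upwards [isOpen_tangent_target.mem_nhds hz] with w hw using rep_eq g hw

theorem horRep_hor_eventuallyEq (hz : z ∈ (extChartAt (𝓡 n).tangent u₀).target) :
    horRep u₀ ((hor g).app X) =ᶠ[𝓝 z] horRep u₀ X := by
  filter_upwards [isOpen_tangent_target.mem_nhds hz] with w hw using horRep_hor g hw

theorem horRep_vert_eventuallyEq (hz : z ∈ (extChartAt (𝓡 n).tangent u₀).target) :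
    horRep u₀ ((vert g).app X) =ᶠ[𝓝 z] fun _ => 0 := by
  filter_upwards [isOpen_tangent_target.mem_nhds hz] with w hw using horRep_vert g hw

theorem vertRep_hor_eventuallyEq (hz : z ∈ (extChartAt (𝓡 n).tangent u₀).target) :
    vertRep g u₀ ((hor g).app X) =ᶠ[𝓝 z] fun _ => 0 := by
  filter_upwards [isOpen_tangent_target.mem_nhds hz] with w hw using vertRep_hor g hw

theorem vertRep_vert_eventuallyEq (hz : z ∈ (extChartAt (𝓡 n).tangent u₀).target) :
    vertRep g u₀ ((vert g).app X) =ᶠ[𝓝 z] vertRep g u₀ X := by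
  filter_upwards [isOpen_tangent_target.mem_nhds hz] with w hw using vertRep_vert g hw

theorem differentiableAt_rep_hor (hz : z ∈ (extChartAt (𝓡 n).tangent u₀).target)
    (hX : DifferentiableAt ℝ (rep u₀ X) z) : DifferentiableAt ℝ (rep u₀ ((hor g).app X)) z :=
  differentiableAt_rep_of_comp g hz
    ((differentiableAt_horRep hX).congr_of_eventuallyEq (horRep_hor_eventuallyEq g hz))
    ((differentiableAt_const 0).congr_of_eventuallyEq (vertRep_hor_eventuallyEq g hz))

theorem differentiableAt_rep_vert (hz : z ∈ (extChartAt (𝓡 n).tangent u₀).target)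
    (hX : DifferentiableAt ℝ (rep u₀ X) z) : DifferentiableAt ℝ (rep u₀ ((vert g).app X)) z :=
  differentiableAt_rep_of_comp g hz
    ((differentiableAt_const 0).congr_of_eventuallyEq (horRep_vert_eventuallyEq g hz))
    ((differentiableAt_vertRep g hz hX).congr_of_eventuallyEq (vertRep_vert_eventuallyEq g hz))

theorem horComp_mlieBracket (hu : u.proj ∈ (extChartAt (𝓡 n) u₀.proj).source)
    (hX : DifferentiableAt ℝ (rep u₀ X) (extChartAt (𝓡 n).tangent u₀ u))
    (hY : DifferentiableAt ℝ (rep u₀ Y) (extChartAt (𝓡 n).tangent u₀ u)) :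
    horComp u₀ u (mlieBracket (𝓡 n).tangent X Y u) =
      fderiv ℝ (horRep u₀ Y) (extChartAt (𝓡 n).tangent u₀ u)
        (rep u₀ X (extChartAt (𝓡 n).tangent u₀ u)) -
      fderiv ℝ (horRep u₀ X) (extChartAt (𝓡 n).tangent u₀ u)
        (rep u₀ Y (extChartAt (𝓡 n).tangent u₀ u)) := by
  rw [horComp, chartD_mlieBracket (mem_extChartAt_tangent_source.2 hu) hX hY, lieBracket]
  have h : ∀ X : VField (𝓡 n).tangent (TangentBundle (𝓡 n) N),
      DifferentiableAt ℝ (rep u₀ X) (extChartAt (𝓡 n).tangent u₀ u) → ∀ v,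
      fderiv ℝ (horRep u₀ X) (extChartAt (𝓡 n).tangent u₀ u) v =
        (fderiv ℝ (rep u₀ X) (extChartAt (𝓡 n).tangent u₀ u) v).1 := fun X hX v => by
    have := (hasFDerivAt_fst.comp _ hX.hasFDerivAt).fderiv
    exact congrArg (fun L => L v) this
  rw [h X hX, h Y hY]
  rfl

/-- Differentiating b + Γ(a, y) produces terms in dΓ and ΓΓ beyond those collected by `covDeriv`;
antisymmetrized, they form the curvature. For horizontal fields only -R(a, a')y is left, the
obstruction to integrability of the horizontal distribution. -/
theorem vertComp_mlieBracket (hu : u.proj ∈ (extChartAt (𝓡 n) u₀.proj).source)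
    (hX : DifferentiableAt ℝ (rep u₀ X) (extChartAt (𝓡 n).tangent u₀ u))
    (hY : DifferentiableAt ℝ (rep u₀ Y) (extChartAt (𝓡 n).tangent u₀ u)) :
    vertComp g u₀ u (mlieBracket (𝓡 n).tangent X Y u) =
      covDeriv (vertForm (christ (coordMetric g u₀.proj))) (rep u₀ X) (vertRep g u₀ Y)
        (extChartAt (𝓡 n).tangent u₀ u) -
      covDeriv (vertForm (christ (coordMetric g u₀.proj))) (rep u₀ Y) (vertRep g u₀ X)
        (extChartAt (𝓡 n).tangent u₀ u) -
      riemann (christ (coordMetric g u₀.proj)) (extChartAt (𝓡 n) u₀.proj u.proj)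
        (horComp u₀ u (X u)) (horComp u₀ u (Y u)) (chartD (𝓡 n) u₀.proj u.proj u.snd) := by
  have hus := mem_extChartAt_tangent_source.2 hu
  have hz := (extChartAt (𝓡 n).tangent u₀).map_source hus
  have hzx : extChartAt (𝓡 n).tangent u₀ u =
    (extChartAt (𝓡 n) u₀.proj u.proj, chartD (𝓡 n) u₀.proj u.proj u.snd) := rfl
  have hval : ∀ X : VField (𝓡 n).tangent (TangentBundle (𝓡 n) N),
    horComp u₀ u (X u) = (rep u₀ X (extChartAt (𝓡 n).tangent u₀ u)).1 := fun X => by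
      rw [rep_apply hus]; rfl
  have hΓ := differentiableAt_christ_fst g hz
  have h : ∀ X : VField (𝓡 n).tangent (TangentBundle (𝓡 n) N),
      DifferentiableAt ℝ (rep u₀ X) (extChartAt (𝓡 n).tangent u₀ u) → ∀ v,
      fderiv ℝ (vertRep g u₀ X) (extChartAt (𝓡 n).tangent u₀ u) v =
        (fderiv ℝ (rep u₀ X) (extChartAt (𝓡 n).tangent u₀ u) v).2 +
        (fderiv ℝ (christ (coordMetric g u₀.proj)) (extChartAt (𝓡 n) u₀.proj u.proj) v.1
          (rep u₀ X (extChartAt (𝓡 n).tangent u₀ u)).1 (chartD (𝓡 n) u₀.proj u.proj u.snd) +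
        christ (coordMetric g u₀.proj) (extChartAt (𝓡 n) u₀.proj u.proj)
          (fderiv ℝ (rep u₀ X) (extChartAt (𝓡 n).tangent u₀ u) v).1
          (chartD (𝓡 n) u₀.proj u.proj u.snd) +
        christ (coordMetric g u₀.proj) (extChartAt (𝓡 n) u₀.proj u.proj)
          (rep u₀ X (extChartAt (𝓡 n).tangent u₀ u)).1 v.2) := fun X hX v => by
    have e : vertRep g u₀ X =ᶠ[𝓝 (extChartAt (𝓡 n).tangent u₀ u)] fun z => (rep u₀ X z).2 +
        christ (coordMetric g u₀.proj) z.1 (rep u₀ X z).1 z.2 := by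
      filter_upwards [isOpen_tangent_target.mem_nhds hz] with w hw using vertRep_eq g hw
    have h1 : HasFDerivAt (fun z => (rep u₀ X z).1) _ (extChartAt (𝓡 n).tangent u₀ u) :=
      hasFDerivAt_fst.comp _ hX.hasFDerivAt
    have h2 : HasFDerivAt (fun z => (rep u₀ X z).2) _ (extChartAt (𝓡 n).tangent u₀ u) :=
      hasFDerivAt_snd.comp _ hX.hasFDerivAt
    have h3 : HasFDerivAt (fun z : EuclideanSpace ℝ (Fin n) × EuclideanSpace ℝ (Fin n) =>
        christ (coordMetric g u₀.proj) z.1) _ (extChartAt (𝓡 n).tangent u₀ u) :=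
      HasFDerivAt.comp (g := christ (coordMetric g u₀.proj)) _
        ((isLocalMetric_coordMetric g u₀.proj).differentiableAt_christ
          (fst_mem_target hz)).hasFDerivAt hasFDerivAt_fst
    have h4 := h2.add ((h3.clm_apply h1).clm_apply hasFDerivAt_snd)
    rw [(h4.congr_of_eventuallyEq e).fderiv]
    simp only [_root_.add_apply, ContinuousLinearMap.comp_apply, ContinuousLinearMap.flip_apply,
      ContinuousLinearMap.coe_fst', ContinuousLinearMap.coe_snd', hzx]
    abel
  rw [vertComp, chartD_mlieBracket hus hX hY, lieBracket, covDeriv, covDeriv, h X hX, h Y hY,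
    vertForm_apply, vertForm_apply, vertRep_eq g hz, vertRep_eq g hz, hval, hval, riemann]
  simp only [Prod.fst_sub, Prod.snd_sub, map_sub, map_add, _root_.sub_apply, hzx]
  abel

end Connection

/-! ### The Vranceanu–Cartan connection in adapted components. -/

section Evaluation

set_option maxSynthPendingDepth 3

variable {n : ℕ} {N : Type*} [TopologicalSpace N] [ChartedSpace (EuclideanSpace ℝ (Fin n)) N]
  [IsManifold (𝓡 n) ∞ N] (g : Metric n N) {u₀ u : TangentBundle (𝓡 n) N}
  {X Y : VField (𝓡 n).tangent (TangentBundle (𝓡 n) N)}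
  {z : EuclideanSpace ℝ (Fin n) × EuclideanSpace ℝ (Fin n)}

theorem hasFDerivAt_coordMetric_fst (hz : z ∈ (extChartAt (𝓡 n).tangent u₀).target) :
    HasFDerivAt (fun z : EuclideanSpace ℝ (Fin n) × EuclideanSpace ℝ (Fin n) =>
      coordMetric g u₀.proj z.1) ((fderiv ℝ (coordMetric g u₀.proj) z.1).comp
        (ContinuousLinearMap.fst ℝ _ _)) z :=
  HasFDerivAt.comp (g := coordMetric g u₀.proj) z
    ((isLocalMetric_coordMetric g u₀.proj).differentiableAt (fst_mem_target hz)).hasFDerivAt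
    hasFDerivAt_fst

/-- Vertical vectors have no x-component, so the derivatives of g_ab(x), the Γ terms and the
curvature term of the bracket all vanish, and so does θ; only the plain derivative remains. -/
theorem comp_koszulDeriv_vert (hu : u.proj ∈ (extChartAt (𝓡 n) u₀.proj).source)
    (hX : DifferentiableAt ℝ (rep u₀ X) (extChartAt (𝓡 n).tangent u₀ u))
    (hY : DifferentiableAt ℝ (rep u₀ Y) (extChartAt (𝓡 n).tangent u₀ u)) :
    horComp u₀ u (koszulDeriv (sasaki g) (cartanForm g) (vert g) X Y u) = 0 ∧
    vertComp g u₀ u (koszulDeriv (sasaki g) (cartanForm g) (vert g) X Y u) =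
      fderiv ℝ (vertRep g u₀ Y) (extChartAt (𝓡 n).tangent u₀ u)
        (rep u₀ ((vert g).app X) (extChartAt (𝓡 n).tangent u₀ u)) := by
  have hm := isLocalMetric_coordMetric g u₀.proj
  have hus := mem_extChartAt_tangent_source.2 hu
  have hz := (extChartAt (𝓡 n).tangent u₀).map_source hus
  have hzx : (extChartAt (𝓡 n).tangent u₀ u).1 = extChartAt (𝓡 n) u₀.proj u.proj := rfl
  have hx : (extChartAt (𝓡 n).tangent u₀ u).1 ∈ (extChartAt (𝓡 n) u₀.proj).target :=
    fst_mem_target hz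
  obtain ⟨v, hv0, hv1⟩ := exists_comp_eq g hu 0 (fderiv ℝ (vertRep g u₀ Y)
    (extChartAt (𝓡 n).tangent u₀ u) (rep u₀ ((vert g).app X) (extChartAt (𝓡 n).tangent u₀ u)))
  suffices h : koszulDeriv (sasaki g) (cartanForm g) (vert g) X Y u = v by
    rw [h]; exact ⟨hv0, hv1⟩
  have hD := (hasFDerivAt_coordMetric_fst g hz).fderiv
  refine koszulDeriv_eq_of_chart hus (vertComp g u₀) (fun z => coordMetric g u₀.proj z.1)
    (fun _ => 0) (hasFDerivAt_coordMetric_fst g hz).differentiableAt (hm.symm _ hx)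
    (fun a b => hm.ext hx) (fun e => ?_) (fun ξ η hξ hη h => ?_) (fun y hy ξ η => ?_)
    (fun ξ => ?_) (fun X hX => differentiableAt_vertRep g hz (differentiableAt_rep_vert g hz hX))
    (fun X Y hX hY => ?_) hX hY ((vert_eq_self_iff g hu).2 hv0) fun ξ => ?_
  · obtain ⟨ξ, -, h⟩ := exists_comp_eq g hu 0 e
    exact ⟨ξ, by rw [vertComp_vert g hu, h]⟩
  · refine ext_comp g hu ?_ h
    rw [(vert_eq_self_iff g hu).1 hξ, (vert_eq_self_iff g hu).1 hη]
  · have hy' := mem_extChartAt_tangent_source.1 hy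
    rw [sasaki_eq g hy', horComp_vert g hy', horComp_vert g hy', map_zero, zero_add]
    rfl
  · rw [cartanForm_eq g hu, horComp_vert g hu, map_zero]
  · rw [vertComp_vert g hu, vertComp_mlieBracket g hu (differentiableAt_rep_vert g hz hX)
      (differentiableAt_rep_vert g hz hY), covDeriv, covDeriv, vertForm_apply, vertForm_apply,
      ← horRep_eq, ← horRep_eq, horRep_vert g hz, horRep_vert g hz]
    have h0 : ∀ X : VField (𝓡 n).tangent (TangentBundle (𝓡 n) N),
      horComp u₀ u ((vert g).app X u) = 0 := fun X => horComp_vert g hu _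
    rw [h0, h0, riemann]
    simp
  · have h0 : ∀ ξ : TangentSpace (𝓡 n).tangent u,
      (chartD (𝓡 n).tangent u₀ u (vert g u ξ)).1 = 0 := fun ξ => horComp_vert g hu _
    rw [hD, hv1, (vertRep_vert_eventuallyEq g hz).fderiv_eq]
    simp only [ContinuousLinearMap.comp_apply, ContinuousLinearMap.coe_fst', h0, map_zero,
      _root_.zero_apply]
    ring

/-- The derivatives of g_ab(x) give Γ as on the base, and the three θ terms with θ = g(y, ·) give
`weylSymbol`. -/
theorem comp_koszulDeriv_hor (hu : u.proj ∈ (extChartAt (𝓡 n) u₀.proj).source)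
    (hX : DifferentiableAt ℝ (rep u₀ X) (extChartAt (𝓡 n).tangent u₀ u))
    (hY : DifferentiableAt ℝ (rep u₀ Y) (extChartAt (𝓡 n).tangent u₀ u)) :
    vertComp g u₀ u (koszulDeriv (sasaki g) (cartanForm g) (hor g) X Y u) = 0 ∧
    horComp u₀ u (koszulDeriv (sasaki g) (cartanForm g) (hor g) X Y u) =
      covDeriv (horForm (coordMetric g u₀.proj)) (rep u₀ ((hor g).app X)) (horRep u₀ Y)
        (extChartAt (𝓡 n).tangent u₀ u) := by
  have hm := isLocalMetric_coordMetric g u₀.proj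
  have hus := mem_extChartAt_tangent_source.2 hu
  have hz := (extChartAt (𝓡 n).tangent u₀).map_source hus
  have hx : (extChartAt (𝓡 n).tangent u₀ u).1 ∈ (extChartAt (𝓡 n) u₀.proj).target :=
    fst_mem_target hz
  obtain ⟨v, hv1, hv0⟩ := exists_comp_eq g hu (covDeriv (horForm (coordMetric g u₀.proj))
    (rep u₀ ((hor g).app X)) (horRep u₀ Y) (extChartAt (𝓡 n).tangent u₀ u)) 0
  suffices h : koszulDeriv (sasaki g) (cartanForm g) (hor g) X Y u = v by
    rw [h]; exact ⟨hv0, hv1⟩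
  have hD := (hasFDerivAt_coordMetric_fst g hz).fderiv
  refine koszulDeriv_eq_of_chart hus (horComp u₀) (fun z => coordMetric g u₀.proj z.1)
    (fun a => coordMetric g u₀.proj (extChartAt (𝓡 n).tangent u₀ u).1
      (extChartAt (𝓡 n).tangent u₀ u).2 a)
    (hasFDerivAt_coordMetric_fst g hz).differentiableAt (hm.symm _ hx)
    (fun a b => hm.ext hx) (fun e => ?_) (fun ξ η hξ hη h => ?_) (fun y hy ξ η => ?_)
    (fun ξ => cartanForm_eq g hu _)
    (fun X hX => differentiableAt_horRep (differentiableAt_rep_hor g hz hX))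
    (fun X Y hX hY => ?_) hX hY ((hor_eq_self_iff g hu).2 hv0) fun ξ => ?_
  · obtain ⟨ξ, h, -⟩ := exists_comp_eq g hu e 0
    exact ⟨ξ, by rw [horComp_hor g hu, h]⟩
  · refine ext_comp g hu h ?_
    rw [(hor_eq_self_iff g hu).1 hξ, (hor_eq_self_iff g hu).1 hη]
  · have hy' := mem_extChartAt_tangent_source.1 hy
    rw [sasaki_eq g hy', vertComp_hor g hy', vertComp_hor g hy', map_zero, add_zero]
    rfl
  · rw [horComp_hor g hu, horComp_mlieBracket hu (differentiableAt_rep_hor g hz hX)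
      (differentiableAt_rep_hor g hz hY)]
  · have h0 : ∀ ξ : TangentSpace (𝓡 n).tangent u,
      (chartD (𝓡 n).tangent u₀ u (hor g u ξ)).1 = horComp u₀ u ξ := fun ξ => horComp_hor g hu _
    have h1 : (rep u₀ ((hor g).app X) (extChartAt (𝓡 n).tangent u₀ u)).1 = horComp u₀ u (X u) := by
      rw [rep_apply hus]; exact h0 _
    have h2 : horRep u₀ Y (extChartAt (𝓡 n).tangent u₀ u) = horComp u₀ u (Y u) :=
      fibreRep_apply hus _ _
    rw [hD, hv1, (horRep_hor_eventuallyEq g hz).fderiv_eq, covDeriv, horForm_apply,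
      weylSymbol_apply, h1, h2]
    simp only [ContinuousLinearMap.comp_apply, ContinuousLinearMap.coe_fst', h0,
      horComp_hor g hu, map_add, map_sub, map_smul, _root_.add_apply, _root_.sub_apply,
      _root_.smul_apply, smul_eq_mul]
    have hs := hm.christ_spec hx (horComp u₀ u (X u)) (horComp u₀ u (Y u)) (horComp u₀ u ξ)
    rw [hm.symm _ hx (horComp u₀ u ξ) (horComp u₀ u (X u))]
    linarith

/-- The Koszul part covers the direction QX and the mixed bracket the direction Q'X. In each mixed
bracket the other field has zero component in the distribution, so the bracket reduces to a
derivative; the two directions add up to X. -/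
theorem comp_connection (hu : u.proj ∈ (extChartAt (𝓡 n) u₀.proj).source)
    (hX : DifferentiableAt ℝ (rep u₀ X) (extChartAt (𝓡 n).tangent u₀ u))
    (hY : DifferentiableAt ℝ (rep u₀ Y) (extChartAt (𝓡 n).tangent u₀ u)) :
    horComp u₀ u (connection g X Y u) =
      covDeriv (horForm (coordMetric g u₀.proj)) (rep u₀ X) (horRep u₀ Y)
        (extChartAt (𝓡 n).tangent u₀ u) ∧
    vertComp g u₀ u (connection g X Y u) =
      covDeriv (vertForm (christ (coordMetric g u₀.proj))) (rep u₀ X) (vertRep g u₀ Y)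
        (extChartAt (𝓡 n).tangent u₀ u) := by
  have hus := mem_extChartAt_tangent_source.2 hu
  have hz := (extChartAt (𝓡 n).tangent u₀).map_source hus
  obtain ⟨hVh, hVv⟩ := comp_koszulDeriv_vert g hu hX hY
  obtain ⟨hHv, hHh⟩ := comp_koszulDeriv_hor g hu hX hY
  have hsum := rep_hor_add_rep_vert g (X := X) (u₀ := u₀) (z := extChartAt (𝓡 n).tangent u₀ u)
  have hHX := differentiableAt_rep_hor g hz hX
  have hVX := differentiableAt_rep_vert g hz hX
  have hHY := differentiableAt_rep_hor g hz hY
  have hVY := differentiableAt_rep_vert g hz hY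
  have hrV : (rep u₀ ((vert g).app X) (extChartAt (𝓡 n).tangent u₀ u)).1 = 0 := by
    rw [← horRep_eq, horRep_vert g hz]
  have hrH : ∀ X : VField (𝓡 n).tangent (TangentBundle (𝓡 n) N),
      (rep u₀ ((hor g).app X) (extChartAt (𝓡 n).tangent u₀ u)).1 =
        (rep u₀ X (extChartAt (𝓡 n).tangent u₀ u)).1 := fun X => by
    rw [← horRep_eq, horRep_hor g hz, horRep_eq]
  have hc0 : ∀ X : VField (𝓡 n).tangent (TangentBundle (𝓡 n) N),
      horComp u₀ u ((vert g).app X u) = 0 := fun X => horComp_vert g hu _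
  rw [connection, vranceanu, weylConn, weylConn]
  constructor
  · rw [horComp_add, horComp_add, horComp_add, hVh, hHh, horComp_vert g hu, horComp_hor g hu,
      horComp_mlieBracket hu hVX hHY, (horRep_vert_eventuallyEq g hz).fderiv_eq,
      (horRep_hor_eventuallyEq g hz).fderiv_eq, covDeriv, covDeriv, horForm_apply, horForm_apply,
      hrH, ← hsum, map_add]
    simp
    abel
  · rw [vertComp_add, vertComp_add, vertComp_add, hVv, hHv, vertComp_vert g hu, vertComp_hor g hu,
      vertComp_mlieBracket g hu hHX hVY, covDeriv, covDeriv, covDeriv,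
      (vertRep_vert_eventuallyEq g hz).fderiv_eq, (vertRep_hor_eventuallyEq g hz).fderiv_eq,
      vertForm_apply, vertForm_apply, vertForm_apply, hrH, vertRep_hor g hz, vertRep_vert g hz,
      hc0, riemann, ← hsum, map_add, Prod.fst_add, hrV, hrH]
    simp
    abel

/-- Curvature differentiates ∇*_Y Z, so the formula is needed on a whole chart domain and not only
at its centre. -/
theorem eqOn_connection
    (hX : ContDiffOn ℝ ∞ (rep u₀ X) (extChartAt (𝓡 n).tangent u₀).target)
    (hY : ContDiffOn ℝ ∞ (rep u₀ Y) (extChartAt (𝓡 n).tangent u₀).target) :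
    EqOn (horRep u₀ (connection g X Y)) (covDeriv (horForm (coordMetric g u₀.proj)) (rep u₀ X)
      (horRep u₀ Y)) (extChartAt (𝓡 n).tangent u₀).target ∧
    EqOn (vertRep g u₀ (connection g X Y)) (covDeriv (vertForm (christ (coordMetric g u₀.proj)))
      (rep u₀ X) (vertRep g u₀ Y)) (extChartAt (𝓡 n).tangent u₀).target := by
  have key : ∀ z ∈ (extChartAt (𝓡 n).tangent u₀).target, _ := fun z hz => by
    have hU := (isOpen_tangent_target (u₀ := u₀)).mem_nhds hz
    have hr := (extChartAt (𝓡 n).tangent u₀).right_inv hz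
    have := comp_connection g (X := X) (Y := Y) (proj_symm_mem hz)
      (by rw [hr]; exact (hX.contDiffAt hU).differentiableAt (by simp))
      (by rw [hr]; exact (hY.contDiffAt hU).differentiableAt (by simp))
    rw [hr] at this
    exact this
  exact ⟨fun z hz => (key z hz).1, fun z hz => (key z hz).2⟩

end Evaluation

/-! ### Curvature of the two connection forms. -/

section FormCurvature

set_option maxSynthPendingDepth 3

variable {E : Type*} [NormedAddCommGroup E] [NormedSpace ℝ E] {z : E × E}

theorem formCurvature_vertForm {Γ : E → E →L[ℝ] E →L[ℝ] E} (h : DifferentiableAt ℝ Γ z.1)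
    (v w : E × E) (c : E) : formCurvature (vertForm Γ) z v w c = riemann Γ z.1 v.1 w.1 c := by
  have h1 : HasFDerivAt (fun z : E × E => Γ z.1) _ z :=
    HasFDerivAt.comp (g := Γ) z h.hasFDerivAt hasFDerivAt_fst
  have h2 : ∀ v w : E × E, fderiv ℝ (vertForm Γ) z v w c = fderiv ℝ Γ z.1 v.1 w.1 c := fun v w => by
    have h3 := h1.clm_comp (hasFDerivAt_const (ContinuousLinearMap.fst ℝ E E) z)
    rw [show fderiv ℝ (vertForm Γ) z = _ from h3.fderiv]
    simp
  rw [formCurvature, h2, h2, riemann]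
  rfl

variable {U : Set E} {m : E → E →L[ℝ] E →L[ℝ] ℝ} [FiniteDimensional ℝ E]

theorem IsLocalMetric.fderiv_horForm (hm : IsLocalMetric U m) (hz : z.1 ∈ U) (v w : E × E)
    (c : E) : fderiv ℝ (horForm m) z v w c =
      fderiv ℝ (fun z => christ m z.1 + weylSymbol m z) z v w.1 c := by
  have h : DifferentiableAt ℝ (fun z : E × E => christ m z.1 + weylSymbol m z) z :=
    (((hm.contDiffOn_christ.comp contDiffOn_fst fun _ hz => hz.1).add
      hm.contDiffOn_weylSymbol).contDiffAt ((hm.isOpen.prod isOpen_univ).mem_nhds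
        ⟨hz, mem_univ _⟩)).differentiableAt (by simp)
  have h3 := h.hasFDerivAt.clm_comp (hasFDerivAt_const (ContinuousLinearMap.fst ℝ E E) z)
  rw [show fderiv ℝ (horForm m) z = _ from h3.fderiv]
  simp

/-- The form involves dx only, so each term of dA + A∧A has a factor evaluated on a vanishing
x-component. -/
theorem IsLocalMetric.formCurvature_horForm_of_fst_eq_zero (hm : IsLocalMetric U m)
    (hz : z.1 ∈ U) {v w : E × E} (hv : v.1 = 0) (hw : w.1 = 0) (c : E) :
    formCurvature (horForm m) z v w c = 0 := by
  rw [formCurvature, hm.fderiv_horForm hz, hm.fderiv_horForm hz, horForm_apply, horForm_apply, hv, hw]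
  simp [horForm_apply, hv, hw]

/-- The form and its derivatives kill (0, b), so only the derivative of the form in the direction
(0, b), evaluated on `w`, survives. Since Γ is independent of y and `weylSymbol` is linear in y,
this derivative is `weylSymbol` with y replaced by b. -/
theorem IsLocalMetric.formCurvature_horForm_of_vertical (hm : IsLocalMetric U m)
    (hz : z.1 ∈ U) (b : E) (w : E × E) (c : E) :
    formCurvature (horForm m) z (0, b) w c =
      (1 / 2 : ℝ) • (m z.1 b w.1 • c + m z.1 b c • w.1 - m z.1 w.1 c • b) := by
  have hd : DifferentiableAt ℝ (horForm m) z :=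
    (hm.contDiffOn_horForm.contDiffAt ((hm.isOpen.prod isOpen_univ).mem_nhds
        ⟨hz, mem_univ _⟩)).differentiableAt (by simp)
  -- The fibre derivative is computed twice along the line z + t(0, b): by the chain rule here, and
  -- from the affine dependence on t in `h2`.
  have h1 : HasDerivAt (fun t : ℝ => horForm m (z + t • (0, b)) w c)
      (fderiv ℝ (horForm m) z (0, b) w c) 0 := by
    have hl : HasDerivAt (fun t : ℝ => z + t • ((0 : E), b)) ((0 : E), b) 0 := by
      simpa using ((hasDerivAt_id (0 : ℝ)).smul_const ((0 : E), b)).const_add z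
    have hd' : HasFDerivAt (horForm m) (fderiv ℝ (horForm m) z) (z + (0 : ℝ) • ((0 : E), b)) := by
      simpa using hd.hasFDerivAt
    have h := hd'.comp_hasDerivAt 0 hl
    have h := (h.clm_apply (hasDerivAt_const 0 w)).clm_apply (hasDerivAt_const 0 c)
    simpa using h
  have h2 : HasDerivAt (fun t : ℝ => horForm m (z + t • (0, b)) w c)
      ((1 / 2 : ℝ) • (m z.1 b w.1 • c + m z.1 b c • w.1 - m z.1 w.1 c • b)) 0 := by
    have e : (fun t : ℝ => horForm m (z + t • (0, b)) w c) = fun t : ℝ => horForm m z w c +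
        t • ((1 / 2 : ℝ) • (m z.1 b w.1 • c + m z.1 b c • w.1 - m z.1 w.1 c • b)) := by
      funext t
      simp only [horForm_apply, weylSymbol_apply, Prod.fst_add, Prod.snd_add, Prod.smul_fst,
        Prod.smul_snd, smul_zero, add_zero, map_add, map_smul, _root_.add_apply,
        _root_.smul_apply, smul_eq_mul]
      module
    rw [e]
    simpa using ((hasDerivAt_id (0 : ℝ)).smul_const
      ((1 / 2 : ℝ) • (m z.1 b w.1 • c + m z.1 b c • w.1 - m z.1 w.1 c • b))).const_add
        (horForm m z w c)
  rw [formCurvature, h1.unique h2, hm.fderiv_horForm hz]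
  simp [horForm_apply]

end FormCurvature

/-! ### Torsion and curvature of the Vranceanu–Cartan connection. -/

section Curvature

set_option maxSynthPendingDepth 3

variable {n : ℕ} {N : Type*} [TopologicalSpace N] [ChartedSpace (EuclideanSpace ℝ (Fin n)) N]
  [IsManifold (𝓡 n) ∞ N] (g : Metric n N) {u₀ u : TangentBundle (𝓡 n) N}
  {X Y Z : VField (𝓡 n).tangent (TangentBundle (𝓡 n) N)}

theorem contDiffOn_christ_fst : ContDiffOn ℝ ∞
    (fun z : EuclideanSpace ℝ (Fin n) × EuclideanSpace ℝ (Fin n) =>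
      christ (coordMetric g u₀.proj) z.1) (extChartAt (𝓡 n).tangent u₀).target :=
  (isLocalMetric_coordMetric g u₀.proj).contDiffOn_christ.comp contDiffOn_fst
    fun _ hz => fst_mem_target hz

theorem contDiffOn_horRep (hX : ContDiffOn ℝ ∞ (rep u₀ X) (extChartAt (𝓡 n).tangent u₀).target) :
    ContDiffOn ℝ ∞ (horRep u₀ X) (extChartAt (𝓡 n).tangent u₀).target :=
  contDiff_fst.comp_contDiffOn hX

theorem contDiffOn_vertRep (hX : ContDiffOn ℝ ∞ (rep u₀ X) (extChartAt (𝓡 n).tangent u₀).target) :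
    ContDiffOn ℝ ∞ (vertRep g u₀ X) (extChartAt (𝓡 n).tangent u₀).target :=
  ((contDiff_snd.comp_contDiffOn hX).add (((contDiffOn_christ_fst g).clm_apply
    (contDiff_fst.comp_contDiffOn hX)).clm_apply contDiffOn_snd)).congr fun _ hz => vertRep_eq g hz

theorem contDiffOn_rep_of_comp
    (h : ContDiffOn ℝ ∞ (horRep u₀ X) (extChartAt (𝓡 n).tangent u₀).target)
    (h' : ContDiffOn ℝ ∞ (vertRep g u₀ X) (extChartAt (𝓡 n).tangent u₀).target) :
    ContDiffOn ℝ ∞ (rep u₀ X) (extChartAt (𝓡 n).tangent u₀).target :=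
  (h.prodMk (h'.sub (((contDiffOn_christ_fst g).clm_apply h).clm_apply contDiffOn_snd))).congr
    fun _ hz => rep_eq g hz

theorem contDiffOn_rep_hor (hX : ContDiffOn ℝ ∞ (rep u₀ X) (extChartAt (𝓡 n).tangent u₀).target) :
    ContDiffOn ℝ ∞ (rep u₀ ((hor g).app X)) (extChartAt (𝓡 n).tangent u₀).target :=
  contDiffOn_rep_of_comp g ((contDiffOn_horRep hX).congr fun _ hz => horRep_hor g hz)
    (contDiffOn_const.congr fun _ hz => vertRep_hor g hz)

theorem contDiffOn_rep_vert (hX : ContDiffOn ℝ ∞ (rep u₀ X) (extChartAt (𝓡 n).tangent u₀).target) :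
    ContDiffOn ℝ ∞ (rep u₀ ((vert g).app X)) (extChartAt (𝓡 n).tangent u₀).target :=
  contDiffOn_rep_of_comp g (contDiffOn_const.congr fun _ hz => horRep_vert g hz)
    ((contDiffOn_vertRep g hX).congr fun _ hz => vertRep_vert g hz)

theorem contDiffOn_horForm : ContDiffOn ℝ ∞ (horForm (coordMetric g u₀.proj))
    (extChartAt (𝓡 n).tangent u₀).target := by
  rw [extChartAt_tangent_target]
  exact (isLocalMetric_coordMetric g u₀.proj).contDiffOn_horForm

theorem contDiffOn_vertForm : ContDiffOn ℝ ∞ (vertForm (christ (coordMetric g u₀.proj)))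
    (extChartAt (𝓡 n).tangent u₀).target := by
  rw [extChartAt_tangent_target]
  exact (isLocalMetric_coordMetric g u₀.proj).contDiffOn_vertForm

theorem contDiffOn_rep_connection
    (hX : ContDiffOn ℝ ∞ (rep u₀ X) (extChartAt (𝓡 n).tangent u₀).target)
    (hY : ContDiffOn ℝ ∞ (rep u₀ Y) (extChartAt (𝓡 n).tangent u₀).target) :
    ContDiffOn ℝ ∞ (rep u₀ (connection g X Y)) (extChartAt (𝓡 n).tangent u₀).target :=
  contDiffOn_rep_of_comp g
    ((contDiffOn_covDeriv isOpen_tangent_target (contDiffOn_horForm g) hX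
      (contDiffOn_horRep hY)).congr (eqOn_connection g hX hY).1)
    ((contDiffOn_covDeriv isOpen_tangent_target (contDiffOn_vertForm g) hX
      (contDiffOn_vertRep g hY)).congr (eqOn_connection g hX hY).2)

theorem horComp_curvature
    (hX : ContDiffOn ℝ ∞ (rep u X) (extChartAt (𝓡 n).tangent u).target)
    (hY : ContDiffOn ℝ ∞ (rep u Y) (extChartAt (𝓡 n).tangent u).target)
    (hZ : ContDiffOn ℝ ∞ (rep u Z) (extChartAt (𝓡 n).tangent u).target) :
    horComp u u (curvature (connection g) X Y Z u) =
      formCurvature (horForm (coordMetric g u.proj)) (extChartAt (𝓡 n).tangent u u)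
        (chartD (𝓡 n).tangent u u (X u)) (chartD (𝓡 n).tangent u u (Y u))
        (horComp u u (Z u)) := by
  have hu := mem_extChartAt_source (I := (𝓡 n).tangent) u
  have key := curvature_of_eqOn_covDeriv (D := connection g) (r := horRep u) (contDiffOn_horForm g)
    (fun X hX => contDiffOn_horRep hX) (fun X Y hX hY => contDiffOn_rep_connection g hX hY)
    (fun X Y hX hY => (eqOn_connection g hX hY).1) hX hY hZ (mem_extChartAt_target u)
  simp only [fibreRep_apply hu, rep_apply hu] at key
  rw [curvature, horComp_sub, horComp_sub, key]

theorem vertComp_curvature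
    (hX : ContDiffOn ℝ ∞ (rep u X) (extChartAt (𝓡 n).tangent u).target)
    (hY : ContDiffOn ℝ ∞ (rep u Y) (extChartAt (𝓡 n).tangent u).target)
    (hZ : ContDiffOn ℝ ∞ (rep u Z) (extChartAt (𝓡 n).tangent u).target) :
    vertComp g u u (curvature (connection g) X Y Z u) =
      riemann (christ (coordMetric g u.proj)) (extChartAt (𝓡 n) u.proj u.proj)
        (horComp u u (X u)) (horComp u u (Y u)) (vertComp g u u (Z u)) := by
  have hu := mem_extChartAt_source (I := (𝓡 n).tangent) u
  have hz := mem_extChartAt_target (I := (𝓡 n).tangent) u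
  have key := curvature_of_eqOn_covDeriv (D := connection g) (r := vertRep g u)
    (contDiffOn_vertForm g)
    (fun X hX => contDiffOn_vertRep g hX) (fun X Y hX hY => contDiffOn_rep_connection g hX hY)
    (fun X Y hX hY => (eqOn_connection g hX hY).2) hX hY hZ hz
  rw [formCurvature_vertForm ((isLocalMetric_coordMetric g u.proj).differentiableAt_christ
    (fst_mem_target hz))] at key
  simp only [fibreRep_apply hu, rep_apply hu] at key
  rw [curvature, vertComp_sub, vertComp_sub, key]
  rfl

/-- Both Γ and `weylSymbol` are symmetric in their two arguments, and the derivative terms match the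
bracket. -/
theorem horComp_torsion
    (hX : DifferentiableAt ℝ (rep u X) (extChartAt (𝓡 n).tangent u u))
    (hY : DifferentiableAt ℝ (rep u Y) (extChartAt (𝓡 n).tangent u u)) :
    horComp u u (torsion (connection g) X Y u) = 0 := by
  have hu := mem_extChartAt_source (I := 𝓡 n) u.proj
  have hx := fst_mem_target (mem_extChartAt_target (I := (𝓡 n).tangent) u)
  have hm := isLocalMetric_coordMetric g u.proj
  rw [torsion, horComp_sub, horComp_sub, (comp_connection g hu hX hY).1,
    (comp_connection g hu hY hX).1, horComp_mlieBracket hu hX hY, covDeriv, covDeriv,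
    horForm_apply, horForm_apply, ← horRep_eq, ← horRep_eq, hm.christ_symm hx, weylSymbol_apply,
    weylSymbol_apply, hm.symm _ hx (horRep u X _)]
  module

/-- The covariant derivatives cancel against those in the bracket, leaving its curvature term with
the sign reversed. -/
theorem vertComp_torsion
    (hX : DifferentiableAt ℝ (rep u X) (extChartAt (𝓡 n).tangent u u))
    (hY : DifferentiableAt ℝ (rep u Y) (extChartAt (𝓡 n).tangent u u)) :
    vertComp g u u (torsion (connection g) X Y u) =
      riemann (christ (coordMetric g u.proj)) (extChartAt (𝓡 n) u.proj u.proj)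
        (horComp u u (X u)) (horComp u u (Y u)) u.snd := by
  have hu := mem_extChartAt_source (I := 𝓡 n) u.proj
  have h : chartD (𝓡 n) u.proj u.proj u.snd = u.snd := chartD_self _
  rw [torsion, vertComp_sub, vertComp_sub, (comp_connection g hu hX hY).2,
    (comp_connection g hu hY hX).2, vertComp_mlieBracket g hu hX hY, sub_sub_cancel]
  exact congrArg _ h

end Curvature

/-! ### The four statements. -/

section Main

variable {n : ℕ} {N : Type*} [TopologicalSpace N] [ChartedSpace (EuclideanSpace ℝ (Fin n)) N]
  [IsManifold (𝓡 n) ∞ N] (g : Metric n N)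

theorem horComp_zero (u : TangentBundle (𝓡 n) N) : horComp u u 0 = 0 := by
  rw [horComp, map_zero]; rfl

theorem vertComp_zero (u : TangentBundle (𝓡 n) N) : vertComp g u u 0 = 0 := by
  rw [vertComp, map_zero]; simp

theorem eq_zero_of_comp {u : TangentBundle (𝓡 n) N} {ξ : TangentSpace (𝓡 n).tangent u}
    (h : horComp u u ξ = 0) (h' : vertComp g u u ξ = 0) : ξ = 0 :=
  ext_comp g (mem_extChartAt_source u.proj) (h.trans (horComp_zero u).symm)
    (h'.trans (vertComp_zero g u).symm)

theorem exists_smoothField_comp_eq [T2Space N] (u : TangentBundle (𝓡 n) N)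
    (a b : EuclideanSpace ℝ (Fin n)) :
    ∃ X : VField (𝓡 n).tangent (TangentBundle (𝓡 n) N), SmoothField X ∧
      horComp u u (X u) = a ∧ vertComp g u u (X u) = b := by
  have := t2Space_tangentBundle (I := 𝓡 n) (M := N)
  obtain ⟨ξ, h⟩ := exists_comp_eq g (mem_extChartAt_source (I := 𝓡 n) u.proj) a b
  obtain ⟨X, hX, rfl⟩ := exists_smoothField (I := (𝓡 n).tangent) (x := u) ξ
  exact ⟨X, hX, h⟩

theorem SmoothField.differentiableAt_rep {X : VField (𝓡 n).tangent (TangentBundle (𝓡 n) N)}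
    (hX : SmoothField X) (u : TangentBundle (𝓡 n) N) :
    DifferentiableAt ℝ (rep u X) (extChartAt (𝓡 n).tangent u u) :=
  ((hX.contDiffOn_rep u).contDiffAt (isOpen_tangent_target.mem_nhds
    (mem_extChartAt_target u))).differentiableAt (by simp)

theorem torsion_eq_zero_iff_isFlat [T2Space N] :
    (∀ X Y : VField (𝓡 n).tangent (TangentBundle (𝓡 n) N), SmoothField X → SmoothField Y →
      ∀ u, torsion (connection g) X Y u = 0) ↔ IsFlat g := by
  rw [isFlat_iff]
  refine ⟨fun h p a b c => ?_, fun h X Y hX hY u => ?_⟩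
  -- The torsion is tested at the point (p, c) of TN: the fibre coordinate supplies the third
  -- argument of the Riemann tensor.
  · obtain ⟨X, hX, rfl, -⟩ := exists_smoothField_comp_eq g ⟨p, c⟩ a 0
    obtain ⟨Y, hY, rfl, -⟩ := exists_smoothField_comp_eq g ⟨p, c⟩ b 0
    have := vertComp_torsion g (hX.differentiableAt_rep ⟨p, c⟩) (hY.differentiableAt_rep ⟨p, c⟩)
    rw [h X Y hX hY, vertComp_zero] at this
    exact this.symm
  · refine eq_zero_of_comp g
      (horComp_torsion g (hX.differentiableAt_rep u) (hY.differentiableAt_rep u)) ?_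
    rw [vertComp_torsion g (hX.differentiableAt_rep u) (hY.differentiableAt_rep u)]
    exact h _ _ _ _

theorem curvature_hor_hor_vert_eq_zero_iff_isFlat [T2Space N] :
    (∀ X Y Z : VField (𝓡 n).tangent (TangentBundle (𝓡 n) N), SmoothField X → SmoothField Y →
      SmoothField Z → ∀ u, curvature (connection g) ((hor g).app X) ((hor g).app Y)
        ((vert g).app Z) u = 0) ↔ IsFlat g := by
  have key : ∀ {X Y Z : VField (𝓡 n).tangent (TangentBundle (𝓡 n) N)}, SmoothField X →
      SmoothField Y → SmoothField Z → ∀ u,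
      vertComp g u u (curvature (connection g) ((hor g).app X) ((hor g).app Y)
        ((vert g).app Z) u) = riemann (christ (coordMetric g u.proj))
        (extChartAt (𝓡 n) u.proj u.proj) (horComp u u (X u)) (horComp u u (Y u))
        (vertComp g u u (Z u)) := fun {X Y Z} hX hY hZ u => by
    have hu := mem_extChartAt_source (I := 𝓡 n) u.proj
    rw [vertComp_curvature g (contDiffOn_rep_hor g (hX.contDiffOn_rep u))
      (contDiffOn_rep_hor g (hY.contDiffOn_rep u)) (contDiffOn_rep_vert g (hZ.contDiffOn_rep u)),
      Endo.app, Endo.app, Endo.app, horComp_hor g hu, horComp_hor g hu, vertComp_vert g hu]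
  rw [isFlat_iff]
  refine ⟨fun h p a b c => ?_, fun h X Y Z hX hY hZ u => eq_zero_of_comp g ?_ ?_⟩
  -- The vertical component of this curvature does not depend on the fibre coordinate, so the zero
  -- vector serves as test point; `c` enters through VZ.
  · obtain ⟨X, hX, rfl, -⟩ := exists_smoothField_comp_eq g ⟨p, 0⟩ a 0
    obtain ⟨Y, hY, rfl, -⟩ := exists_smoothField_comp_eq g ⟨p, 0⟩ b 0
    obtain ⟨Z, hZ, -, rfl⟩ := exists_smoothField_comp_eq g ⟨p, 0⟩ 0 c
    have := key hX hY hZ ⟨p, 0⟩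
    rw [h X Y Z hX hY hZ, vertComp_zero] at this
    exact this.symm
  -- VZ has zero horizontal component, and the curvature of the horizontal form is linear in it.
  · rw [horComp_curvature g (contDiffOn_rep_hor g (hX.contDiffOn_rep u))
      (contDiffOn_rep_hor g (hY.contDiffOn_rep u)) (contDiffOn_rep_vert g (hZ.contDiffOn_rep u)),
      Endo.app, Endo.app, Endo.app, horComp_vert g (mem_extChartAt_source (I := 𝓡 n) u.proj),
      formCurvature]
    simp
  · rw [key hX hY hZ]
    exact h _ _ _ _

theorem exists_curvature_vert_hor_ne_zero [T2Space N] (hn : 0 < n) (u : TangentBundle (𝓡 n) N) :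
    ∃ X Y Z : VField (𝓡 n).tangent (TangentBundle (𝓡 n) N), SmoothField X ∧ SmoothField Y ∧
      SmoothField Z ∧
      curvature (connection g) ((vert g).app X) ((hor g).app Y) Z u ≠ 0 := by
  have : Nonempty (Fin n) := ⟨⟨0, hn⟩⟩
  have hx := fst_mem_target (mem_extChartAt_target (I := (𝓡 n).tangent) u)
  have hu := mem_extChartAt_source (I := 𝓡 n) u.proj
  have hm := isLocalMetric_coordMetric g u.proj
  -- With b in all three slots, two of the three terms of the curvature cancel and ½ g(b, b)b
  -- remains. Positivity of n supplies b ≠ 0.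
  obtain ⟨b, hb⟩ := exists_ne (0 : EuclideanSpace ℝ (Fin n))
  obtain ⟨X, hX, -, hXb⟩ := exists_smoothField_comp_eq g u 0 b
  obtain ⟨Y, hY, hYb, -⟩ := exists_smoothField_comp_eq g u b 0
  refine ⟨X, Y, Y, hX, hY, hY, fun h => ?_⟩
  have key := horComp_curvature g (contDiffOn_rep_vert g (hX.contDiffOn_rep u))
    (contDiffOn_rep_hor g (hY.contDiffOn_rep u)) (hY.contDiffOn_rep u)
  rw [h, horComp_zero, Endo.app, Endo.app, chartD_vert g hu,
    hm.formCurvature_horForm_of_vertical hx] at key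
  have hY' : (chartD (𝓡 n).tangent u u (hor g u (Y u))).1 = b := (horComp_hor g hu _).trans hYb
  rw [hY', hXb, hYb, add_sub_cancel_right] at key
  rcases smul_eq_zero.1 key.symm with h0 | h0
  · norm_num at h0
  · exact (smul_ne_zero (hm.pos _ hx b hb).ne' hb) h0

theorem curvature_vert_vert {X Y Z : VField (𝓡 n).tangent (TangentBundle (𝓡 n) N)}
    (hX : SmoothField X) (hY : SmoothField Y) (hZ : SmoothField Z) (u : TangentBundle (𝓡 n) N) :
    curvature (connection g) ((vert g).app X) ((vert g).app Y) Z u = 0 := by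
  have hx := fst_mem_target (mem_extChartAt_target (I := (𝓡 n).tangent) u)
  have hu := mem_extChartAt_source (I := 𝓡 n) u.proj
  have hm := isLocalMetric_coordMetric g u.proj
  have hX' := contDiffOn_rep_vert g (hX.contDiffOn_rep u)
  have hY' := contDiffOn_rep_vert g (hY.contDiffOn_rep u)
  refine eq_zero_of_comp g ?_ ?_
  · rw [horComp_curvature g hX' hY' (hZ.contDiffOn_rep u)]
    exact hm.formCurvature_horForm_of_fst_eq_zero hx (horComp_vert g hu _) (horComp_vert g hu _) _
  · rw [vertComp_curvature g hX' hY' (hZ.contDiffOn_rep u), Endo.app, Endo.app,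
      horComp_vert g hu, horComp_vert g hu, riemann]
    simp

end Main

end VranceanuCartan

end

theorem proposition3p11 {n : ℕ} {N : Type*} [TopologicalSpace N] [T2Space N]
    [ChartedSpace (EuclideanSpace ℝ (Fin n)) N] [IsManifold (𝓡 n) ∞ N]
    (g : VranceanuCartan.Metric n N) :
    -- torsion-free if and only if the base is flat
    ((∀ X Y : VranceanuCartan.VField (𝓡 n).tangent (TangentBundle (𝓡 n) N),
        VranceanuCartan.SmoothField X → VranceanuCartan.SmoothField Y →
        ∀ u, VranceanuCartan.torsion (VranceanuCartan.connection g) X Y u = 0) ↔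
      VranceanuCartan.IsFlat g) ∧
    -- `R*(HX, HY)VZ = 0` if and only if the base is flat
    ((∀ X Y Z : VranceanuCartan.VField (𝓡 n).tangent (TangentBundle (𝓡 n) N),
        VranceanuCartan.SmoothField X → VranceanuCartan.SmoothField Y →
        VranceanuCartan.SmoothField Z →
        ∀ u, VranceanuCartan.curvature (VranceanuCartan.connection g)
          ((VranceanuCartan.hor g).app X) ((VranceanuCartan.hor g).app Y)
          ((VranceanuCartan.vert g).app Z) u = 0) ↔
      VranceanuCartan.IsFlat g) ∧
    -- never vertical-horizontal flat: `R*(V·, H·)` vanishes at no point of `TN`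
    (0 < n →
      ∀ u : TangentBundle (𝓡 n) N,
        ∃ X Y Z : VranceanuCartan.VField (𝓡 n).tangent (TangentBundle (𝓡 n) N),
          VranceanuCartan.SmoothField X ∧ VranceanuCartan.SmoothField Y ∧
          VranceanuCartan.SmoothField Z ∧
          VranceanuCartan.curvature (VranceanuCartan.connection g)
            ((VranceanuCartan.vert g).app X) ((VranceanuCartan.hor g).app Y) Z u ≠ 0) ∧
    -- vertical flat: `R*(V·, V·) = 0`
    (∀ X Y Z : VranceanuCartan.VField (𝓡 n).tangent (TangentBundle (𝓡 n) N),
      VranceanuCartan.SmoothField X → VranceanuCartan.SmoothField Y →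
      VranceanuCartan.SmoothField Z →
      ∀ u, VranceanuCartan.curvature (VranceanuCartan.connection g)
        ((VranceanuCartan.vert g).app X) ((VranceanuCartan.vert g).app Y) Z u = 0) := by
  exact ⟨VranceanuCartan.torsion_eq_zero_iff_isFlat g,
    VranceanuCartan.curvature_hor_hor_vert_eq_zero_iff_isFlat g,
    VranceanuCartan.exists_curvature_vert_hor_ne_zero g,
    fun _ _ _ hX hY hZ u => VranceanuCartan.curvature_vert_vert g hX hY hZ u⟩
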